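/- Let $k$ be a commutative artinian ring and let $\Lambda$ be an artin $k$-algebra (that is, $\Lambda$ is finitely generated as a $k$-module) that is basic and connected. All modules are finitely generated left modules. Suppose $\Lambda$ is a Nakayama algebra: every indecomposable projective and every indecomposable injective $\Lambda$-module is uniserial, i.e. its submodules are totally ordered by inclusion. Let $(P_1,\dots,P_n)$ be a Kupisch series of $\Lambda$: a complete list of pairwise non-isomorphic indecomposable projective $\Lambda$-modules such that, with $S_i:=P_i/\operatorname{rad}P_i$, with $l$ denoting length, and with $\tau^{-1}=\mathrm{Tr}\,D$ the inverse Auslander–Reiten translate, (a) $S_{i+1}\cong\tau^{-1}S_i$ for $1\le i\le n-1$, and $S_1\cong\tau^{-1}S_n$ if $l(P_1)\ne 1$; (b) $l(P_i)\ge 2$ for $2\le i\le n$; (c) $l(P_{i+1})\le l(P_i)+1$ for $1\le i\le n-1$, and $l(P_1)\le l(P_n)+1$. Put $c_i:=l(P_i)$, read all indices in $\mathbb Z/n\mathbb Z$, and set $$\mathcal Q_c=\{i\mid c_{i+1}\le c_i\},\qquad \mathcal P_c=\{i\mid c_{i+1}=c_i+1\},\qquad \delta(i)=\min\{k\in\mathbb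 N\mid i+k\in\mathcal Q_c\}.$$ Let $\widetilde Q$ be the direct sum of representatives of the isomorphism classes of all indecomposable projective-injective $\Lambda$-modules, and let $\mathcal C_\Lambda=\operatorname{Gen}\widetilde Q\cap\operatorname{Cogen}\widetilde Q$ be the class of modules that are quotients of some $\widetilde Q^{\,a}$ and submodules of some $\widetilde Q^{\,b}$. A tilting module is a basic module $T$ with $\operatorname{pd}T\le 1$, $\operatorname{Ext}^1_\Lambda(T,T)=0$, and an exact sequence $0\to\Lambda\to T_0\to T_1\to 0$ with $T_0,T_1\in\operatorname{add}T$. **Theorem.** If $T_{\mathcal C}$ is a tilting module lying in $\mathcal C_\Lambda$, then $$T_{\mathcal C}\;\cong\;\Bigl(\bigoplus_{j\in\mathcal Q_c}P_j\Bigr)\oplus\Bigl(\bigoplus_{i\in\mathcal P_c}T_i\Bigr),$$ where each $T_i$ is a uniserial $\Lambda$-module with socle $\operatorname{soc}T_i\cong S_{i+1}$ and length $l(T_i)=\delta(i)$. -/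

import Mathlib

universe u

open scoped DirectSum

namespace NakayamaTilting

section Modules

variable (Λ : Type u) [Ring Λ] (M : Type u) [AddCommGroup M] [Module Λ M]

/-- The submodules of `M` are totally ordered by inclusion. -/
def IsUniserial : Prop :=
  ∀ N L : Submodule Λ M, N ≤ L ∨ L ≤ N

/-- `M` is nonzero and has no decomposition into two nonzero direct summands. -/
def IsIndecomposable : Prop :=
  Nontrivial M ∧ ∀ N L : Submodule Λ M, IsCompl N L → N = ⊥ ∨ L = ⊥

/-- `M` is a finite direct sum of pairwise non-isomorphic indecomposable submodules. -/
def IsBasicModule : Prop :=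
  ∃ (m : ℕ) (X : Fin m → Submodule Λ M), DirectSum.IsInternal X ∧
    (∀ i, IsIndecomposable Λ (X i)) ∧
    ∀ i j, Nonempty (X i ≃ₗ[Λ] X j) → i = j

/-- The socle: the sum of all simple submodules. -/
def socle : Submodule Λ M :=
  sSup {N : Submodule Λ M | IsSimpleModule Λ N}

/-- The top `M / rad M`, where `rad M` is the intersection of all maximal submodules. -/
abbrev Top : Type u := M ⧸ Module.jacobson Λ M

variable {Λ M}

/-- A superfluous submodule. -/
def IsSuperfluous (N : Submodule Λ M) : Prop :=
  ∀ L : Submodule Λ M, L ⊔ N = ⊤ → L = ⊤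

/-- An essential submodule. -/
def IsEssentialSubmodule (N : Submodule Λ M) : Prop :=
  ∀ L : Submodule Λ M, L ⊓ N = ⊥ → L = ⊥

end Modules

section Algebras

variable (Λ : Type u) [Ring Λ]

/-- `Λ` is a nonzero ring whose only central idempotents are `0` and `1`. -/
def IsConnectedRing : Prop :=
  Nontrivial Λ ∧ ∀ e : Λ, e * e = e → (∀ x : Λ, e * x = x * e) → e = 0 ∨ e = 1

/-- All indecomposable projective and all indecomposable injective finitely generated left
modules are uniserial. (This is applied to artin algebras only.) -/
def IsNakayama : Prop :=
  ∀ M : ModuleCat.{u} Λ, Module.Finite Λ M → IsIndecomposable Λ M →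
    (Module.Projective Λ M ∨ Module.Injective Λ M) → IsUniserial Λ M

end Algebras

section Translate

variable (k : Type u) [CommRing k]

/-- `E` is an injective envelope of the `k`-module `k / rad k`. -/
def IsMinimalInjectiveCogenerator (E : Type u) [AddCommGroup E] [Module k E] : Prop :=
  Module.Injective k E ∧ ∃ ι : (k ⧸ Ring.jacobson k) →ₗ[k] E,
    Function.Injective ι ∧ IsEssentialSubmodule (LinearMap.range ι)

variable (Λ : Type u) [Ring Λ] [Algebra k Λ]

/-- The right `Λ`-module `Y` is isomorphic to `Hom_k(M, E)` with the right action
`(φ a)(m) = φ (a m)`. -/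
def IsDualModule (E : Type u) [AddCommGroup E] [Module k E]
    (M : Type u) [AddCommGroup M] [Module Λ M]
    (Y : Type u) [AddCommGroup Y] [Module Λᵐᵒᵖ Y] : Prop :=
  letI : Module k M := Module.compHom M (algebraMap k Λ)
  ∃ φ : Y ≃+ (M →ₗ[k] E), ∀ (a : Λ) (y : Y) (m : M), φ (MulOpposite.op a • y) m = φ y (a • m)

/-- `Q₁ → Q₀ → Y → 0` (with maps `f` and `g`) is a minimal projective presentation of the
module `Y` over the ring `R`, by finitely generated projective modules. -/
structure IsMinimalPresentation (R : Type u) [Ring R] {Q₁ Q₀ Y : Type u}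
    [AddCommGroup Q₁] [Module R Q₁] [AddCommGroup Q₀] [Module R Q₀] [AddCommGroup Y] [Module R Y]
    (f : Q₁ →ₗ[R] Q₀) (g : Q₀ →ₗ[R] Y) : Prop where
  finite_one : Module.Finite R Q₁
  finite_zero : Module.Finite R Q₀
  projective_one : Module.Projective R Q₁
  projective_zero : Module.Projective R Q₀
  surjective : Function.Surjective g
  exact : Function.Exact f g
  superfluous_zero : IsSuperfluous (LinearMap.ker g)
  superfluous_one : IsSuperfluous (LinearMap.ker f)

/-- The left `Λ`-module `C` is isomorphic to the transpose of the right `Λ`-module `Y`: the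
cokernel of `Hom(f, Λ) : Hom(Q₀, Λ) → Hom(Q₁, Λ)` for a minimal projective presentation
`f : Q₁ → Q₀` of `Y`. -/
def IsTranspose (Y : Type u) [AddCommGroup Y] [Module Λᵐᵒᵖ Y]
    (C : Type u) [AddCommGroup C] [Module Λ C] : Prop :=
  ∃ (Q₁ Q₀ : ModuleCat.{u} Λᵐᵒᵖ) (f : Q₁ →ₗ[Λᵐᵒᵖ] Q₀) (g : Q₀ →ₗ[Λᵐᵒᵖ] Y)
    (π : (Q₁ →ₗ[Λᵐᵒᵖ] Λ) →ₗ[Λ] C),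
    IsMinimalPresentation Λᵐᵒᵖ f g ∧ Function.Surjective π ∧
      ∀ h : Q₁ →ₗ[Λᵐᵒᵖ] Λ, π h = 0 ↔ ∃ h₀ : Q₀ →ₗ[Λᵐᵒᵖ] Λ, h = h₀ ∘ₗ f

/-- `C` is isomorphic to the inverse Auslander-Reiten translate `τ⁻¹ A = Tr D A`, where
`D = Hom_k(-, E)` and `E` is the injective envelope of `k / rad k`. -/
def IsInverseTranslate (A : Type u) [AddCommGroup A] [Module Λ A]
    (C : Type u) [AddCommGroup C] [Module Λ C] : Prop :=
  ∃ (E : ModuleCat.{u} k) (Y : ModuleCat.{u} Λᵐᵒᵖ),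
    IsMinimalInjectiveCogenerator k E ∧ IsDualModule k Λ E A Y ∧ IsTranspose Λ Y C

end Translate

section Kupisch

/-- `P 1, P 2, …, P n` is a Kupisch series of the artin `k`-algebra `Λ`. The index set
`{1, …, n}` is `ZMod n`, with `n` represented by `0`. -/
structure IsKupischSeries (k : Type u) [CommRing k] (Λ : Type u) [Ring Λ] [Algebra k Λ]
    {n : ℕ} [NeZero n] (P : ZMod n → ModuleCat.{u} Λ) : Prop where
  finite : ∀ i, Module.Finite Λ (P i)
  projective : ∀ i, Module.Projective Λ (P i)
  indecomposable : ∀ i, IsIndecomposable Λ (P i)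
  eq_of_iso : ∀ i j, Nonempty (P i ≃ₗ[Λ] P j) → i = j
  exists_iso : ∀ M : ModuleCat.{u} Λ, Module.Finite Λ M → Module.Projective Λ M →
    IsIndecomposable Λ M → ∃ i, Nonempty (M ≃ₗ[Λ] P i)
  translate : ∀ i, (i ≠ 0 ∨ Module.length Λ (P 1) ≠ 1) →
    IsInverseTranslate k Λ (Top Λ (P i)) (Top Λ (P (i + 1)))
  two_le_length : ∀ i, i ≠ 1 → 2 ≤ Module.length Λ (P i)
  length_le : ∀ i, Module.length Λ (P (i + 1)) ≤ Module.length Λ (P i) + 1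

variable {n : ℕ} [NeZero n] (c : ZMod n → ℕ)

/-- The set `𝒬_c` of all `i` with `c_{i+1} ≤ c_i`. -/
def setQ : Set (ZMod n) := {i | c (i + 1) ≤ c i}

/-- The set `𝒫_c` of all `i` with `c_{i+1} = c_i + 1`. -/
def setP : Set (ZMod n) := {i | c (i + 1) = c i + 1}

/-- `δ(i) = min {k ∈ ℕ | i + k ∈ 𝒬_c}`. -/
noncomputable def delta (i : ZMod n) : ℕ := sInf {k : ℕ | i + (k : ZMod n) ∈ setQ c}

/-- The minimum in the definition of `δ(i)` is attained. -/
theorem isLeast_delta (i : ZMod n) : IsLeast {k : ℕ | i + (k : ZMod n) ∈ setQ c} (delta c i) := by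
  have hne : {k : ℕ | i + (k : ZMod n) ∈ setQ c}.Nonempty := by
    by_contra hcon
    have hlt : ∀ k : ℕ, c (i + (k : ZMod n)) < c (i + (k : ZMod n) + 1) := fun k => by
      by_contra h
      exact hcon ⟨k, not_lt.mp h⟩
    have hmono : StrictMono fun k : ℕ => c (i + (k : ZMod n)) :=
      strictMono_nat_of_lt_succ fun k => by
        have := hlt k
        rwa [add_assoc, ← Nat.cast_succ] at this
    have h := hmono (Nat.pos_of_ne_zero (NeZero.ne n))
    simp at h
  exact ⟨Nat.sInf_mem hne, fun k hk => Nat.sInf_le hk⟩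

end Kupisch

section Tilting

variable (Λ : Type u) [Ring Λ]

/-- `Q` lists representatives of the isomorphism classes of all indecomposable finitely
generated projective-injective `Λ`-modules. -/
structure IsProjInjRepresentatives {t : ℕ} (Q : Fin t → ModuleCat.{u} Λ) : Prop where
  finite : ∀ i, Module.Finite Λ (Q i)
  projective : ∀ i, Module.Projective Λ (Q i)
  injective : ∀ i, Module.Injective Λ (Q i)
  indecomposable : ∀ i, IsIndecomposable Λ (Q i)
  eq_of_iso : ∀ i j, Nonempty (Q i ≃ₗ[Λ] Q j) → i = j
  exists_iso : ∀ M : ModuleCat.{u} Λ, Module.Finite Λ M → Module.Projective Λ M →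
    Module.Injective Λ M → IsIndecomposable Λ M → ∃ i, Nonempty (M ≃ₗ[Λ] Q i)

variable (X T : Type u) [AddCommGroup X] [Module Λ X] [AddCommGroup T] [Module Λ T]

/-- `X` is in `𝒞_Λ = Gen Q̃ ∩ Cogen Q̃`: it is finitely generated, a quotient of some `Q̃ ^ a` and
a submodule of some `Q̃ ^ b`, where `Q̃` is the direct sum of representatives of the isomorphism
classes of all indecomposable projective-injective modules. -/
def MemC : Prop :=
  Module.Finite Λ X ∧
    ∃ (t : ℕ) (Q : Fin t → ModuleCat.{u} Λ), IsProjInjRepresentatives Λ Q ∧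
      (∃ (a : ℕ) (p : (Fin a → ⨁ i, Q i) →ₗ[Λ] X), Function.Surjective p) ∧
      (∃ (b : ℕ) (j : X →ₗ[Λ] (Fin b → ⨁ i, Q i)), Function.Injective j)

/-- `X` is in `add T`: it is a direct summand of some `T ^ m`. -/
def MemAdd : Prop :=
  ∃ (m : ℕ) (j : X →ₗ[Λ] (Fin m → T)) (p : (Fin m → T) →ₗ[Λ] X), p ∘ₗ j = LinearMap.id

/-- `T` is a (classical) tilting module: finitely generated, basic, with `pd T ≤ 1`,
`Ext¹(T, T) = 0`, and an exact sequence `0 → Λ → T₀ → T₁ → 0` with `T₀`, `T₁` in `add T`. -/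
structure IsTilting : Prop where
  finite : Module.Finite Λ T
  basic : IsBasicModule Λ T
  projectiveDimension_le_one :
    CategoryTheory.HasProjectiveDimensionLE (ModuleCat.of Λ T) 1
  ext_eq_zero :
    Subsingleton (CategoryTheory.Abelian.Ext.{u} (ModuleCat.of Λ T) (ModuleCat.of Λ T) 1)
  exists_coresolution :
    ∃ (T₀ T₁ : ModuleCat.{u} Λ) (f : Λ →ₗ[Λ] T₀) (g : T₀ →ₗ[Λ] T₁),
      MemAdd Λ T₀ T ∧ MemAdd Λ T₁ T ∧
      Function.Injective f ∧ Function.Exact f g ∧ Function.Surjective g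

end Tilting

end NakayamaTilting

/-! The Kupisch series controls how the indecomposable projectives sit inside each other. The
translate condition forces `rad P (i+1)` to be a quotient of `P i` (`exists_surjective_jacobson`),
and from this a uniserial module whose radical is `P i` must be `P (i+1)`, with length `c i + 1`
(`nonempty_equiv_of_isCoatom`). So for `i` in `setQ c` nothing uniserial lies just above `P i` in
its indecomposable injective hull, and `P i` is injective (`injective_of_length_le`). For `i` in
`setP c` one climbs `P i ⊂ P (i+1) ⊂ ⋯`, the length growing by one each time, up to the first index
in `setQ c`, namely `i + δ(i)`. The cokernel `W i` is uniserial of length `δ(i)`, and the submodule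
just above `P i` is `P (i+1)`, so the socle of `W i` is the top of `P (i+1)`.

It remains to see that the tilting module `T` and the sum of the `P j` (`j` in `setQ c`) and the `W
i` (`i` in `setP c`) have the same summands. A module in `𝒞_Λ` is a quotient of an injective module,
so maps into it from a projective module extend along embeddings. Comparing `0 → P i → P j → W i →
0` with the coresolution `0 → Λ → T₀ → T₁ → 0` then puts `W i` in `add T` (`memAdd_of_exact`).
Conversely, `pd T ≤ 1` makes `T` a retract of a pushout built from the sequences of the `P i`
(`memAdd_of_projectiveDimension_le_one`). Krull–Schmidt, with both sides basic, finishes the proof.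
-/

namespace NakayamaTilting

/-! ### Uniserial modules: local tops, simple socles, no proper summands. -/

section Uniserial

variable {Λ : Type*} [Ring Λ] {M N : Type*} [AddCommGroup M] [Module Λ M]
  [AddCommGroup N] [Module Λ N]

/-- `M` has no decomposition into two nonzero direct summands; `M` may be zero. -/
def HasTrivialSummands (Λ : Type*) [Ring Λ] (M : Type*) [AddCommGroup M] [Module Λ M] : Prop :=
  ∀ N L : Submodule Λ M, IsCompl N L → N = ⊥ ∨ L = ⊥

theorem IsUniserial.of_surjective {Λ M N : Type u} [Ring Λ] [AddCommGroup M] [Module Λ M]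
    [AddCommGroup N] [Module Λ N] (h : IsUniserial Λ M) (f : M →ₗ[Λ] N)
    (hf : Function.Surjective f) : IsUniserial Λ N := fun A B => by
  rcases h (A.comap f) (B.comap f) with h | h
  · exact .inl ((Submodule.comap_le_comap_iff_of_surjective hf).1 h)
  · exact .inr ((Submodule.comap_le_comap_iff_of_surjective hf).1 h)

theorem IsUniserial.of_injective {Λ M N : Type u} [Ring Λ] [AddCommGroup M] [Module Λ M]
    [AddCommGroup N] [Module Λ N] (h : IsUniserial Λ N) (f : M →ₗ[Λ] N)
    (hf : Function.Injective f) : IsUniserial Λ M := fun A B => by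
  rcases h (A.map f) (B.map f) with h | h
  · exact .inl ((Submodule.map_le_map_iff_of_injective hf _ _).1 h)
  · exact .inr ((Submodule.map_le_map_iff_of_injective hf _ _).1 h)

theorem IsUniserial.hasTrivialSummands {Λ M : Type u} [Ring Λ] [AddCommGroup M] [Module Λ M]
    (h : IsUniserial Λ M) : HasTrivialSummands Λ M := fun A B hAB => by
  rcases h A B with h | h
  · exact .inl (by simpa [inf_eq_left.2 h] using hAB.inf_eq_bot)
  · exact .inr (by simpa [inf_eq_right.2 h] using hAB.inf_eq_bot)

/-- A nonzero module which is a retract of a module without proper summands is all of it. -/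
theorem HasTrivialSummands.bijective_of_comp_bijective [Nontrivial N]
    (h : HasTrivialSummands Λ M) (i : N →ₗ[Λ] M) (q : M →ₗ[Λ] N)
    (hqi : Function.Bijective (q ∘ₗ i)) : Function.Bijective i := by
  have hi : Function.Injective i := fun x y hxy => hqi.1 (by simp [hxy])
  refine ⟨hi, ?_⟩
  have hc : IsCompl (LinearMap.range i) (LinearMap.ker q) := by
    constructor
    · rw [Submodule.disjoint_def]
      rintro _ ⟨x, rfl⟩ hx
      have : x = 0 := hqi.1 (by simpa using hx)
      simp [this]
    · rw [codisjoint_iff, eq_top_iff]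
      intro x _
      obtain ⟨y, hy⟩ := hqi.2 (q x)
      refine Submodule.mem_sup.2 ⟨i y, ⟨y, rfl⟩, x - i y, ?_, by abel⟩
      simpa [sub_eq_zero] using hy.symm
  rcases h _ _ hc with h | h
  · obtain ⟨x, hx⟩ := exists_ne (0 : N)
    exact absurd (hi (by simpa using (LinearMap.range_eq_bot.1 h ▸ rfl : i x = 0))) hx
  · rw [← LinearMap.range_eq_top, ← hc.sup_eq_top, h, sup_bot_eq]

theorem HasTrivialSummands.bijective_of_comp_eq_id [Nontrivial N]
    (h : HasTrivialSummands Λ M) (i : N →ₗ[Λ] M) (q : M →ₗ[Λ] N)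
    (hqi : q ∘ₗ i = LinearMap.id) : Function.Bijective i :=
  h.bijective_of_comp_bijective i q (hqi ▸ Function.bijective_id)

/-- The surjection splits, and its section embeds `N` as a nonzero summand, hence onto. -/
theorem HasTrivialSummands.bijective_of_surjective [Nontrivial N] [Module.Projective Λ N]
    (h : HasTrivialSummands Λ M) (f : M →ₗ[Λ] N) (hf : Function.Surjective f) :
    Function.Bijective f := by
  obtain ⟨s, hs⟩ := Module.projective_lifting_property f LinearMap.id hf
  have hb := h.bijective_of_comp_eq_id s f hs
  have : f = (LinearEquiv.ofBijective s hb).symm.toLinearMap := by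
    ext x
    obtain ⟨y, rfl⟩ := hb.2 x
    have h1 : f (s y) = y := LinearMap.congr_fun hs y
    simp [h1]
  rw [this]
  exact (LinearEquiv.ofBijective s hb).symm.bijective

variable {Λ : Type u} [Ring Λ] {M : Type u} [AddCommGroup M] [Module Λ M]
  {N : Type u} [AddCommGroup N] [Module Λ N]

theorem IsUniserial.isCoatom_jacobson [Module.Finite Λ M] [Nontrivial M] (h : IsUniserial Λ M) :
    IsCoatom (Module.jacobson Λ M) := by
  obtain ⟨m, hm, -⟩ := (eq_top_or_exists_le_coatom (⊥ : Submodule Λ M)).resolve_left bot_ne_top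
  have : Module.jacobson Λ M = m := by
    refine le_antisymm (sInf_le hm) (le_sInf fun m' hm' => ?_)
    rcases h m m' with h | h
    · exact h
    · exact (hm'.le_iff.1 h).elim (fun h => absurd h hm.1) (fun h => h.le)
  exact this ▸ hm

theorem IsUniserial.le_jacobson [Module.Finite Λ M] (h : IsUniserial Λ M)
    {A : Submodule Λ M} (hA : A ≠ ⊤) : A ≤ Module.jacobson Λ M := by
  obtain ⟨m, hm, hle⟩ := (eq_top_or_exists_le_coatom A).resolve_left hA
  refine le_sInf fun m' hm' => ?_
  rcases h m m' with h | h
  · exact hle.trans h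
  · exact (hm'.le_iff.1 h).elim (fun h => absurd h hm.1) (fun h => h ▸ hle)

theorem IsUniserial.surjective_of_not_mem_jacobson [Module.Finite Λ M] (h : IsUniserial Λ M)
    (f : N →ₗ[Λ] M) {x : N} (hx : f x ∉ Module.jacobson Λ M) : Function.Surjective f := by
  rw [← LinearMap.range_eq_top]
  by_contra hne
  exact hx (h.le_jacobson hne ⟨x, rfl⟩)

theorem IsUniserial.exists_notMem_jacobson [Module.Finite Λ M] [Nontrivial M]
    (h : IsUniserial Λ M) : ∃ x, x ∉ Module.jacobson Λ M := by
  by_contra hcon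
  push Not at hcon
  exact h.isCoatom_jacobson.1 (eq_top_iff.2 fun y _ => hcon y)

/-- A map to a local module whose composite with the projection to the top is onto is onto. -/
theorem IsUniserial.surjective_of_top [Module.Finite Λ M] [Nontrivial M] (h : IsUniserial Λ M)
    (f : N →ₗ[Λ] M)
    (hf : Function.Surjective ((Module.jacobson Λ M).mkQ ∘ₗ f)) : Function.Surjective f := by
  obtain ⟨y, hy⟩ := h.exists_notMem_jacobson
  obtain ⟨x, hx⟩ := hf (Submodule.Quotient.mk y)
  refine h.surjective_of_not_mem_jacobson f (x := x) fun hmem => hy ?_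
  rw [← Submodule.Quotient.mk_eq_zero] at hmem ⊢
  rw [← hx, ← hmem]
  rfl

theorem IsUniserial.isSimpleModule_top [Module.Finite Λ M] [Nontrivial M] (h : IsUniserial Λ M) :
    IsSimpleModule Λ (Top Λ M) :=
  isSimpleModule_iff_isCoatom.2 h.isCoatom_jacobson

/-- A submodule with simple quotient of a uniserial module is its radical. -/
theorem IsUniserial.eq_jacobson [Module.Finite Λ M] (h : IsUniserial Λ M) {A : Submodule Λ M}
    (hA : IsCoatom A) : A = Module.jacobson Λ M :=
  le_antisymm (h.le_jacobson hA.1) (sInf_le hA)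

/-- The socle of a uniserial module is any of its simple submodules. -/
theorem IsUniserial.socle_eq (h : IsUniserial Λ M) {A : Submodule Λ M}
    (hA : IsSimpleModule Λ A) : socle Λ M = A := by
  refine le_antisymm (sSup_le fun B hB => ?_) (le_sSup hA)
  have hA := isSimpleModule_iff_isAtom.1 hA
  have hB := isSimpleModule_iff_isAtom.1 (show IsSimpleModule Λ B from hB)
  rcases h A B with h | h
  · exact (hB.le_iff.1 h).elim (fun h => absurd h hA.1) (fun h => h.ge)
  · exact h

theorem map_socle_le (e : M ≃ₗ[Λ] N) : (socle Λ M).map e.toLinearMap ≤ socle Λ N := by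
  rw [Submodule.map_le_iff_le_comap]
  refine sSup_le fun A hA => Submodule.map_le_iff_le_comap.1 (le_sSup ?_)
  have : IsSimpleModule Λ A := hA
  exact IsSimpleModule.congr (e.submoduleMap A).symm

theorem nonempty_socle_equiv_socle (e : M ≃ₗ[Λ] N) : Nonempty (socle Λ M ≃ₗ[Λ] socle Λ N) := by
  have h : (socle Λ M).map e.toLinearMap = socle Λ N := by
    refine le_antisymm (map_socle_le e) fun x hx => ⟨e.symm x, ?_, by simp⟩
    exact map_socle_le e.symm ⟨x, hx, rfl⟩
  exact ⟨e.submoduleMap _ ≪≫ₗ LinearEquiv.ofEq _ _ h⟩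

theorem jacobson_map_equiv (e : M ≃ₗ[Λ] N) :
    (Module.jacobson Λ M).map e.toLinearMap = Module.jacobson Λ N :=
  Module.map_jacobson_of_bijective e.bijective

theorem nonempty_top_equiv (e : M ≃ₗ[Λ] N) : Nonempty (Top Λ M ≃ₗ[Λ] Top Λ N) :=
  ⟨Submodule.Quotient.equiv _ _ e (jacobson_map_equiv e)⟩

end Uniserial

/-! ### Local endomorphism rings and the Krull–Schmidt exchange. -/

section Fitting

variable {Λ : Type*} [Ring Λ] {M : Type*} [AddCommGroup M] [Module Λ M]

/-- Fitting's lemma. -/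
theorem HasTrivialSummands.isLocalRing_end [IsNoetherian Λ M] [IsArtinian Λ M] [Nontrivial M]
    (h : HasTrivialSummands Λ M) : IsLocalRing (Module.End Λ M) := by
  refine IsLocalRing.of_isUnit_or_isUnit_of_isUnit_add fun a b hab => ?_
  have key : ∀ f : Module.End Λ M, IsUnit f ∨ IsNilpotent f := fun f => by
    obtain ⟨n, hn⟩ := Filter.eventually_atTop.1 f.eventually_isCompl_ker_pow_range_pow
    -- The exponent `n + 1` is nonzero, so invertibility of the power passes to `f`.
    have hc := hn (n + 1) (by omega)
    rcases h _ _ hc with h | h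
    · left
      have hb : Function.Bijective (f ^ (n + 1)) := by
        refine ⟨LinearMap.ker_eq_bot.1 h, LinearMap.range_eq_top.1 ?_⟩
        simpa [h] using hc.sup_eq_top
      have hu : IsUnit (f ^ (n + 1)) := (Module.End.isUnit_iff _).2 hb
      exact (isUnit_pow_iff (Nat.succ_ne_zero n)).1 hu
    · exact .inr ⟨n + 1, LinearMap.range_eq_bot.1 h⟩
  obtain ⟨v, hv⟩ := hab
  rcases key (↑v⁻¹ * a) with h1 | h1
  · left
    simpa using v.isUnit.mul h1
  · right
    have h2 := h1.isUnit_one_sub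
    have h3 : (1 : Module.End Λ M) - ↑v⁻¹ * a = ↑v⁻¹ * b := by
      rw [← Units.inv_mul v, ← mul_sub, hv]; congr 1; simp
    rw [h3] at h2
    simpa using v.isUnit.mul h2

/-- An indecomposable module of finite length which is a retract of a finite product of modules
without proper summands is isomorphic to one of them. -/
theorem HasTrivialSummands.exists_equiv_of_retract_pi [IsNoetherian Λ M] [IsArtinian Λ M]
    [Nontrivial M] (h : HasTrivialSummands Λ M) {ι : Type*} [Fintype ι] {Z : ι → Type*}
    [∀ s, AddCommGroup (Z s)] [∀ s, Module Λ (Z s)] (hZ : ∀ s, HasTrivialSummands Λ (Z s))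
    (i : M →ₗ[Λ] ∀ s, Z s) (q : (∀ s, Z s) →ₗ[Λ] M) (hqi : q ∘ₗ i = LinearMap.id) :
    ∃ s, Nonempty (M ≃ₗ[Λ] Z s) := by
  classical
  have := h.isLocalRing_end
  -- The identity is the sum of the endomorphisms factoring through the single `Z s`; in a local
  -- ring one of these is a unit.
  have hsum : ∑ s, ((q ∘ₗ LinearMap.single Λ Z s) ∘ₗ (LinearMap.proj s ∘ₗ i)) =
      (1 : Module.End Λ M) := by
    ext x
    have h1 : q (i x) = x := LinearMap.congr_fun hqi x
    conv_rhs => rw [Module.End.one_apply, ← h1, ← Finset.univ_sum_single (i x), map_sum]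
    simp
  obtain ⟨s, -, hs⟩ := IsLocalRing.exists_of_isUnit_sum (hsum ▸ isUnit_one)
  exact ⟨s, ⟨LinearEquiv.ofBijective _
    ((hZ s).bijective_of_comp_bijective _ _ ((Module.End.isUnit_iff _).1 hs))⟩⟩

end Fitting

/-! ### Comparison of short exact sequences. -/

section Retract

variable {Λ : Type*} [Ring Λ] {K B C K' B' C' : Type*}
  [AddCommGroup K] [Module Λ K] [AddCommGroup B] [Module Λ B] [AddCommGroup C] [Module Λ C]
  [AddCommGroup K'] [Module Λ K'] [AddCommGroup B'] [Module Λ B'] [AddCommGroup C'] [Module Λ C']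

theorem exists_factor_of_exact (f : K →ₗ[Λ] B) (g : B →ₗ[Λ] C) (hfg : Function.Exact f g)
    (hg : Function.Surjective g) (h : B →ₗ[Λ] C') (hh : h ∘ₗ f = 0) :
    ∃ h' : C →ₗ[Λ] C', h' ∘ₗ g = h := by
  have hle : LinearMap.ker g ≤ LinearMap.ker h := by
    intro x hx
    obtain ⟨y, rfl⟩ := (hfg x).1 hx
    exact LinearMap.congr_fun hh y
  refine ⟨(LinearMap.ker g).liftQ h hle ∘ₗ (g.quotKerEquivOfSurjective hg).symm.toLinearMap, ?_⟩
  ext x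
  have : (g.quotKerEquivOfSurjective hg).symm (g x) = Submodule.Quotient.mk x := by
    rw [LinearEquiv.symm_apply_eq]; rfl
  simp [this]

/-- If `0 → K → B → C → 0` and `0 → K' → B' → C' → 0` are exact, and the retraction of `K'` onto
`K` is covered by maps between `B` and `B'`, then `C` is a retract of `C' × B`. -/
theorem exists_retract_of_exact (f : K →ₗ[Λ] B) (g : B →ₗ[Λ] C) (hfg : Function.Exact f g)
    (hg : Function.Surjective g) (f' : K' →ₗ[Λ] B') (g' : B' →ₗ[Λ] C')
    (hfg' : Function.Exact f' g') (hg' : Function.Surjective g')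
    (s : K →ₗ[Λ] K') (p : K' →ₗ[Λ] K) (hps : p ∘ₗ s = LinearMap.id)
    (v : B →ₗ[Λ] B') (w : B' →ₗ[Λ] B) (hv : v ∘ₗ f = f' ∘ₗ s) (hw : w ∘ₗ f' = f ∘ₗ p) :
    ∃ (i : C →ₗ[Λ] C') (q : C' →ₗ[Λ] C) (r : C →ₗ[Λ] B), q ∘ₗ i + g ∘ₗ r = LinearMap.id := by
  have hwv : w ∘ₗ v ∘ₗ f = f := by
    rw [hv, ← LinearMap.comp_assoc, hw, LinearMap.comp_assoc, hps, LinearMap.comp_id]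
  obtain ⟨i, hi⟩ := exists_factor_of_exact f g hfg hg (g' ∘ₗ v) (by
    rw [LinearMap.comp_assoc, hv, ← LinearMap.comp_assoc, hfg'.linearMap_comp_eq_zero,
      LinearMap.zero_comp])
  obtain ⟨q, hq⟩ := exists_factor_of_exact f' g' hfg' hg' (g ∘ₗ w) (by
    rw [LinearMap.comp_assoc, hw, ← LinearMap.comp_assoc, hfg.linearMap_comp_eq_zero,
      LinearMap.zero_comp])
  -- `w ∘ v` need not be the identity of `B`, but it fixes the image of `K`; the error therefore
  -- descends to `C` and becomes the part of the retraction passing through `B`.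
  obtain ⟨r, hr⟩ := exists_factor_of_exact f g hfg hg (LinearMap.id - w ∘ₗ v) (by
    rw [LinearMap.sub_comp, LinearMap.comp_assoc, hwv, LinearMap.id_comp, sub_self])
  refine ⟨i, q, r, ?_⟩
  ext x
  obtain ⟨y, rfl⟩ := hg x
  have h1 : i (g y) = g' (v y) := LinearMap.congr_fun hi y
  have h2 : q (g' (v y)) = g (w (v y)) := LinearMap.congr_fun hq (v y)
  have h3 : r (g y) = y - w (v y) := LinearMap.congr_fun hr y
  simp [h1, h2, h3]

end Retract

end NakayamaTilting

/-! ### Duals of projective right modules. -/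

namespace NakayamaTilting

section RightDual

variable {Λ : Type u} [Ring Λ]

theorem exists_dualBasis {Q : Type u} [AddCommGroup Q] [Module Λᵐᵒᵖ Q] [Module.Finite Λᵐᵒᵖ Q]
    [Module.Projective Λᵐᵒᵖ Q] :
    ∃ (m : ℕ) (x : Fin m → Q) (h : Fin m → Q →ₗ[Λᵐᵒᵖ] Λ),
      ∀ q, ∑ s, MulOpposite.op (h s q) • x s = q := by
  obtain ⟨m, p, hp⟩ := Module.Finite.exists_fin' Λᵐᵒᵖ Q
  obtain ⟨t, ht⟩ := Module.projective_lifting_property p LinearMap.id hp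
  refine ⟨m, fun s => p (Pi.single s 1), fun s =>
    { toFun := fun q => (t q s).unop
      map_add' := fun a b => by simp
      map_smul' := fun a b => by simp }, fun q => ?_⟩
  have h1 : p (t q) = q := LinearMap.congr_fun ht q
  conv_rhs => rw [← h1, ← Finset.univ_sum_single (t q), map_sum]
  refine Finset.sum_congr rfl fun s _ => ?_
  rw [← map_smul, ← Pi.single_smul]
  simp

theorem rightDual_eq_sum {Q : Type u} [AddCommGroup Q] [Module Λᵐᵒᵖ Q] {m : ℕ} {x : Fin m → Q}
    {h : Fin m → Q →ₗ[Λᵐᵒᵖ] Λ} (hx : ∀ q, ∑ s, MulOpposite.op (h s q) • x s = q)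
    (f : Q →ₗ[Λᵐᵒᵖ] Λ) : f = ∑ s, f (x s) • h s := by
  ext q
  conv_lhs => rw [← hx q, map_sum]
  simp [LinearMap.sum_apply]

theorem projective_rightDual {Q : Type u} [AddCommGroup Q] [Module Λᵐᵒᵖ Q]
    [Module.Finite Λᵐᵒᵖ Q] [Module.Projective Λᵐᵒᵖ Q] :
    Module.Projective Λ (Q →ₗ[Λᵐᵒᵖ] Λ) := by
  obtain ⟨m, x, h, hx⟩ := exists_dualBasis (Λ := Λ) (Q := Q)
  refine Module.Projective.of_split (M := Fin m → Λ)
    (LinearMap.pi fun s =>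
      { toFun := fun f => f (x s), map_add' := fun _ _ => rfl, map_smul' := fun _ _ => rfl })
    (Fintype.linearCombination Λ h) ?_
  ext1 f
  exact (rightDual_eq_sum hx f).symm

/-- If `Q → Y` is a projective cover of a right module `Y` killed by the ideal `A`, then `A` kills
every simple quotient of the left module `Hom(Q, Λ)`. -/
theorem smul_eq_zero_of_rightDual [IsNoetherianRing Λ] {Q Y : Type u} [AddCommGroup Q]
    [Module Λᵐᵒᵖ Q] [Module.Finite Λᵐᵒᵖ Q] [Module.Projective Λᵐᵒᵖ Q] [AddCommGroup Y]
    [Module Λᵐᵒᵖ Y] (g : Q →ₗ[Λᵐᵒᵖ] Y) (hg : IsSuperfluous (LinearMap.ker g))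
    {S : Type u} [AddCommGroup S] [Module Λ S] [IsSimpleModule Λ S]
    (θ : (Q →ₗ[Λᵐᵒᵖ] Λ) →ₗ[Λ] S) (hθ : θ ≠ 0) (a : Λ)
    (ha : ∀ (b : Λ) (y : Y), MulOpposite.op (b * a) • y = 0) (v : S) : a • v = 0 := by
  by_contra hav
  obtain ⟨m, x, h, hx⟩ := exists_dualBasis (Λ := Λ) (Q := Q)
  obtain ⟨f, hf⟩ : ∃ f, θ f ≠ 0 := by
    by_contra hcon
    push Not at hcon
    exact hθ (LinearMap.ext hcon)
  obtain ⟨s, hs⟩ : ∃ s, f (x s) • θ (h s) ≠ 0 := by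
    by_contra hcon
    push Not at hcon
    rw [rightDual_eq_sum hx f, map_sum] at hf
    exact hf (Finset.sum_eq_zero fun s _ => by rw [map_smul]; exact hcon s)
  -- Since `a • v` generates `S`, the element `q = x s · (b a)` lies in `ker g` while `f q` acts on
  -- `v` without killing it.
  obtain ⟨b, hb⟩ := IsSimpleModule.toSpanSingleton_surjective Λ hav (θ (h s))
  rw [LinearMap.toSpanSingleton_apply] at hb
  set q : Q := MulOpposite.op (b * a) • x s
  have hq : q ∈ LinearMap.ker g := by
    rw [LinearMap.mem_ker, map_smul, ha]
  have hz : f q • v ≠ 0 := by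
    have : f q = f (x s) * (b * a) := by simp [q]
    rwa [this, mul_smul, mul_smul, hb]
  set z := f q
  obtain ⟨r, hr⟩ := IsSimpleModule.toSpanSingleton_surjective Λ hz v
  rw [LinearMap.toSpanSingleton_apply] at hr
  -- Here `r z v = v`. Modulo `ker g` every element of `Q` can be moved into `f⁻¹(L)`, so
  -- superfluity gives `f⁻¹(L) = Q` and `1 ∈ L`. Then `1 - z r` is invertible, hence so is `1 - r
  -- z`, although it kills `v ≠ 0`.
  let L : Submodule Λᵐᵒᵖ Λ := Submodule.span Λᵐᵒᵖ {1 - z * r}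
  have hcomap : L.comap f = ⊤ := by
    refine hg _ (eq_top_iff.2 fun q' _ => ?_)
    refine Submodule.mem_sup.2 ⟨q' - MulOpposite.op (r * f q') • q, ?_,
      MulOpposite.op (r * f q') • q, Submodule.smul_mem _ _ hq, by abel⟩
    refine Submodule.mem_span_singleton.2 ⟨MulOpposite.op (f q'), ?_⟩
    simp [z, sub_mul, mul_assoc]
  have hone : (1 : Λ) ∈ L := by
    have h1 : z ∈ L := by
      have : q ∈ L.comap f := hcomap ▸ trivial
      exact this
    have h2 : z * r ∈ L := by simpa using L.smul_mem (MulOpposite.op r) h1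
    simpa using L.add_mem (Submodule.mem_span_singleton_self (1 - z * r)) h2
  obtain ⟨w, hw⟩ := Submodule.mem_span_singleton.1 hone
  have hw1 : (1 - z * r) * w.unop = 1 := hw
  have hw2 : w.unop * (1 - z * r) = 1 := mul_eq_one_symm hw1
  have hw3 : (1 + r * w.unop * z) * (1 - r * z) = 1 := by
    have : (1 + r * w.unop * z) * (1 - r * z) =
      1 - r * z + r * (w.unop * (1 - z * r)) * z := by noncomm_ring
    rw [this, hw2]; simp
  have hv : v = 0 := by
    have h4 : (1 - r * z) • v = 0 := by rw [sub_smul, one_smul, mul_smul, hr, sub_self]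
    rw [← one_smul Λ v, ← hw3, mul_smul, h4, smul_zero]
  exact hav (by rw [hv, smul_zero])

end RightDual

/-! ### The inverse translate of a simple module and the second radical layer. -/

section Translate

variable {k : Type u} [CommRing k] {Λ : Type u} [Ring Λ] [Algebra k Λ] [IsNoetherianRing Λ]

/-- If `Top N` is the inverse translate of the simple module `S` and the radical of the uniserial
module `N` is nonzero, then the annihilator of `S` kills the top of the radical of `N`. -/
theorem IsInverseTranslate.smul_eq_zero {S N R : Type u} [AddCommGroup S] [Module Λ S]
    [AddCommGroup N] [Module Λ N] [Module.Finite Λ N] [Nontrivial N] (hN : IsUniserial Λ N)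
    (h : IsInverseTranslate k Λ S (Top Λ N)) [AddCommGroup R] [Module Λ R] [IsSimpleModule Λ R]
    (ρ : Module.jacobson Λ N →ₗ[Λ] R) (hρ : Function.Surjective ρ) (a : Λ)
    (ha : ∀ x : S, a • x = 0) (v : R) : a • v = 0 := by
  obtain ⟨E, Y, -, ⟨φ, hφ⟩, Q₁, Q₀, f, g, π, hpres, hπ, hker⟩ := h
  have := hpres.finite_zero
  have := hpres.finite_one
  have := hpres.projective_zero
  have := hpres.projective_one
  have : Module.Projective Λ (Q₁ →ₗ[Λᵐᵒᵖ] Λ) := projective_rightDual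
  -- The lift of `π` to `N` is onto because `N` is local. It carries the image of `Hom(Q₀, Λ)` onto
  -- `rad N`, so `R` is a simple quotient of the dual of the projective cover of `D S`.
  obtain ⟨t, ht⟩ := Module.projective_lifting_property (Module.jacobson Λ N).mkQ π
    (Submodule.mkQ_surjective _)
  have hts : Function.Surjective t := hN.surjective_of_top t (ht ▸ hπ)
  have hmem : ∀ h₁ : Q₁ →ₗ[Λᵐᵒᵖ] Λ, t h₁ ∈ Module.jacobson Λ N ↔ π h₁ = 0 := fun h₁ => by
    rw [← Submodule.Quotient.mk_eq_zero, ← ht]; rfl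
  let ψ : (Q₀ →ₗ[Λᵐᵒᵖ] Λ) →ₗ[Λ] Module.jacobson Λ N :=
    { toFun := fun h₀ => ⟨t (h₀ ∘ₗ f), (hmem _).2 ((hker _).2 ⟨h₀, rfl⟩)⟩
      map_add' := fun a b => Subtype.ext (by simp [LinearMap.add_comp])
      map_smul' := fun a b => Subtype.ext (by simp [LinearMap.smul_comp]) }
  have hψ : Function.Surjective ψ := fun y => by
    obtain ⟨h₁, hh₁⟩ := hts y
    obtain ⟨h₀, rfl⟩ := (hker h₁).1 ((hmem h₁).1 (hh₁ ▸ y.2))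
    exact ⟨h₀, Subtype.ext hh₁⟩
  refine smul_eq_zero_of_rightDual g hpres.superfluous_zero (ρ ∘ₗ ψ) ?_ a ?_ v
  · intro h0
    have := IsSimpleModule.nontrivial Λ R
    obtain ⟨y, hy⟩ := exists_ne (0 : R)
    obtain ⟨x, rfl⟩ := hρ y
    obtain ⟨z, rfl⟩ := hψ x
    exact hy (LinearMap.congr_fun h0 z)
  · intro b y
    let : Module k S := Module.compHom S (algebraMap k Λ)
    refine φ.injective (LinearMap.ext fun m => ?_)
    rw [hφ, mul_smul, ha, smul_zero, map_zero, map_zero]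
    rfl

end Translate

end NakayamaTilting

/-! ### Duality over the artinian base ring. -/

namespace NakayamaTilting

section Duality

variable {k : Type u} [CommRing k]

/-- Induction on length. A map from a simple module to `E` lands in the essential submodule `k / rad
k`, so evaluation at a generator embeds `Hom(M ⧸ N, E)` in a noetherian module. -/
theorem IsMinimalInjectiveCogenerator.isNoetherian_linearMap [IsArtinianRing k] {E : Type u}
    [AddCommGroup E] [Module k E] (hE : IsMinimalInjectiveCogenerator k E)
    {M : Type u} [AddCommGroup M] [Module k M] (hM : IsFiniteLength k M) :
    IsNoetherian k (M →ₗ[k] E) := by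
  obtain ⟨-, ι, -, hess⟩ := hE
  induction hM with
  | of_subsingleton => exact inferInstance
  | @of_simple_quotient M _ _ N hs _ ih =>
    have hquot : IsNoetherian k ((M ⧸ N) →ₗ[k] E) := by
      have := IsSimpleModule.nontrivial k (M ⧸ N)
      obtain ⟨x, hx⟩ := exists_ne (0 : M ⧸ N)
      have hspan := IsSimpleModule.toSpanSingleton_surjective k hx
      have hmem : ∀ f : (M ⧸ N) →ₗ[k] E, f x ∈ LinearMap.range ι := fun f => by
        by_contra hfx
        have hbot : LinearMap.range f ⊓ LinearMap.range ι ≠ ⊥ := fun h => by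
          have := hess _ h
          exact hfx (by rw [LinearMap.range_eq_bot.1 this]; simp)
        obtain ⟨_, ⟨⟨y, rfl⟩, hy⟩, hy0⟩ := Submodule.exists_mem_ne_zero_of_ne_bot hbot
        have hyne : y ≠ 0 := fun h => hy0 (by rw [h, map_zero])
        obtain ⟨r, rfl⟩ := IsSimpleModule.toSpanSingleton_surjective k hyne x
        exact hfx (by simpa using Submodule.smul_mem _ r hy)
      let ev : ((M ⧸ N) →ₗ[k] E) →ₗ[k] LinearMap.range ι :=
        (LinearMap.applyₗ x).codRestrict _ hmem
      refine isNoetherian_of_injective ev fun f g hfg => LinearMap.ext fun y => ?_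
      obtain ⟨r, rfl⟩ := hspan y
      have h1 : f x = g x := congrArg Subtype.val hfg
      simp [h1]
    refine isNoetherian_of_range_eq_ker (N.mkQ.lcomp k E) (N.subtype.lcomp k E) ?_
    ext f
    constructor
    · rintro ⟨g, rfl⟩
      refine LinearMap.ext fun y => ?_
      have h1 : N.mkQ (y : M) = 0 := (Submodule.Quotient.mk_eq_zero N).2 y.2
      change g (N.mkQ (y : M)) = 0
      rw [h1, map_zero]
    · intro hf
      exact ⟨N.liftQ f fun y hy => LinearMap.congr_fun hf ⟨y, hy⟩, LinearMap.ext fun y => rfl⟩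

/-- The annihilator of `x ≠ 0` lies in a maximal ideal `m`. By semisimplicity `k / rad k` contains
some `a ≠ 0` killed by `m`, so `x ↦ ι a` is well defined on `k x` and extends to `M`. -/
theorem IsMinimalInjectiveCogenerator.exists_linearMap_ne_zero [IsArtinianRing k] {E : Type u}
    [AddCommGroup E] [Module k E] (hE : IsMinimalInjectiveCogenerator k E)
    {M : Type u} [AddCommGroup M] [Module k M] [Nontrivial M] : ∃ f : M →ₗ[k] E, f ≠ 0 := by
  obtain ⟨hinj, ι, hι, -⟩ := hE
  obtain ⟨x, hx⟩ := exists_ne (0 : M)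
  have hker : LinearMap.ker (LinearMap.toSpanSingleton k M x) ≠ ⊤ := fun h => hx (by
    have : (1 : k) ∈ LinearMap.ker (LinearMap.toSpanSingleton k M x) := h ▸ trivial
    simpa using this)
  obtain ⟨m, hm, hle⟩ := Ideal.exists_le_maximal _ hker
  have hJ : Ring.jacobson k ≤ m := Ring.jacobson_le_of_isMaximal m
  let mbar : Ideal (k ⧸ Ring.jacobson k) := m.map (Ideal.Quotient.mk _)
  have hmbar : mbar ≠ ⊤ := fun h => hm.ne_top (by
    have : m = mbar.comap (Ideal.Quotient.mk _) := by
      rw [Ideal.comap_map_of_surjective' _ Ideal.Quotient.mk_surjective, Ideal.mk_ker,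
        sup_eq_left.2 hJ]
    rw [this, h, Ideal.comap_top])
  obtain ⟨A, hA⟩ := exists_isCompl mbar
  have hAbot : A ≠ ⊥ := fun h => hmbar (by simpa [h] using hA.sup_eq_top)
  obtain ⟨a, haA, ha⟩ := Submodule.exists_mem_ne_zero_of_ne_bot hAbot
  have hma : ∀ r ∈ m, r • a = 0 := fun r hr => by
    have h1 : r • a = Ideal.Quotient.mk _ r * a := rfl
    have h2 : Ideal.Quotient.mk _ r * a ∈ mbar ⊓ A :=
      ⟨mbar.mul_mem_right _ (Ideal.mem_map_of_mem _ hr), A.mul_mem_left _ haA⟩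
    rw [hA.inf_eq_bot] at h2
    rw [h1]
    exact h2
  let γ := (LinearMap.toSpanSingleton k M x).rangeRestrict
  obtain ⟨χ, hχ⟩ := exists_factor_of_exact (LinearMap.ker γ).subtype γ
    (LinearMap.exact_subtype_ker_map γ) (LinearMap.surjective_rangeRestrict _)
    (LinearMap.toSpanSingleton k E (ι a)) (by
      ext ⟨r, hr⟩
      have hr' : r ∈ m := hle (by simpa [γ] using hr)
      simp [← map_smul, hma r hr'])
  obtain ⟨f, hf⟩ := Module.Injective.extension_property k E _ M
    (Submodule.subtype _) (Submodule.subtype_injective _) χ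
  refine ⟨f, fun h0 => ha (hι ?_)⟩
  have h1 : χ (γ 1) = ι a := by simpa using LinearMap.congr_fun hχ 1
  rw [map_zero, ← h1, ← hf, h0]
  simp

open CategoryTheory in
theorem IsMinimalInjectiveCogenerator.exists_hom_ne_zero [IsArtinianRing k] {E : Type u}
    [AddCommGroup E] [Module k E] (hE : IsMinimalInjectiveCogenerator k E)
    (M : ModuleCat.{u} k) [Nontrivial M] : ∃ f : M ⟶ ModuleCat.of k E, f ≠ 0 := by
  obtain ⟨f, hf⟩ := hE.exists_linearMap_ne_zero (M := M)
  exact ⟨ModuleCat.ofHom f, fun h => hf (congrArg ModuleCat.Hom.hom h)⟩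

variable {Λ : Type u} [Ring Λ]

open CategoryTheory in
/-- The dual of the regular right module. -/
theorem IsMinimalInjectiveCogenerator.exists_injective_cogenerator [IsArtinianRing k]
    [Algebra k Λ] [Module.Finite k Λ] {E : Type u}
    [AddCommGroup E] [Module k E] (hE : IsMinimalInjectiveCogenerator k E) :
    ∃ D : ModuleCat.{u} Λ, Module.Finite Λ D ∧ Module.Injective Λ D ∧
      ∀ (M : Type u) [AddCommGroup M] [Module Λ M] [Nontrivial M],
        ∃ f : M →ₗ[Λ] D, f ≠ 0 := by
  let F := algebraMap k Λ
  let D := (ModuleCat.coextendScalars F).obj (ModuleCat.of k E)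
  refine ⟨D, ?_, ?_, fun M _ _ _ => ?_⟩
  · have hfl : IsFiniteLength k Λ := isFiniteLength_iff_isNoetherian_isArtinian.2
      ⟨isNoetherian_of_isNoetherianRing_of_finite k Λ, isArtinian_of_fg_of_artinian'⟩
    have hfl' : IsFiniteLength k ((ModuleCat.restrictScalars F).obj (ModuleCat.of Λ Λ)) :=
      LinearEquiv.isFiniteLength
        (N := ((ModuleCat.restrictScalars F).obj (ModuleCat.of Λ Λ)))
        { AddEquiv.refl Λ with map_smul' := fun r x => Algebra.smul_def r x } hfl
    have hN := hE.isNoetherian_linearMap hfl'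
    have hw : WellFoundedGT (Submodule k
      (((ModuleCat.restrictScalars F).obj (ModuleCat.of Λ Λ)) →ₗ[k] E)) := inferInstance
    let G : Submodule Λ D → Submodule k
        (((ModuleCat.restrictScalars F).obj (ModuleCat.of Λ Λ)) →ₗ[k] E) := fun N =>
      { carrier := {f | (show D from f) ∈ N}
        add_mem' := fun {a b} ha hb => N.add_mem ha hb
        zero_mem' := N.zero_mem
        smul_mem' := fun r f hf => by
          have h1 : (show D from r • f) = F r • (show D from f) := by
            refine LinearMap.ext (fun x : Λ => ?_)
            change r • f x = f (x * F r)
            exact (f.map_smul r x).symm.trans (congrArg f (Algebra.commutes r x))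
          change (show D from r • f) ∈ N
          rw [h1]
          exact N.smul_mem _ hf }
    -- Submodules over `Λ` are in particular `k`-submodules of `Hom_k(Λ, E)`, whose ascending chain
    -- condition pulls back.
    have hG : StrictMono G := fun N L hNL => by
      rw [SetLike.lt_iff_le_and_exists] at hNL ⊢
      obtain ⟨hle, x, hx, hx'⟩ := hNL
      exact ⟨fun y hy => hle hy, x, hx, hx'⟩
    have : IsNoetherian Λ D := isNoetherian_iff'.2 hG.wellFoundedGT
    infer_instance
  · have : Module.Injective k E := hE.1
    have : Injective (ModuleCat.of k E) := Module.injective_object_of_injective_module k E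
    have : Injective D := Injective.injective_of_adjoint (ModuleCat.restrictCoextendScalarsAdj F) _
    exact Module.injective_module_of_injective_object Λ D
  · let Mk : ModuleCat.{u} k := (ModuleCat.restrictScalars F).obj (ModuleCat.of Λ M)
    have : Nontrivial Mk := inferInstanceAs (Nontrivial M)
    obtain ⟨χ, hχ⟩ := hE.exists_hom_ne_zero Mk
    let e : (Mk ⟶ ModuleCat.of k E) ≃ (ModuleCat.of Λ M ⟶ D) :=
      (ModuleCat.restrictCoextendScalarsAdj F).homEquiv _ _
    -- Only bijectivity of the adjunction is needed: of two distinct maps at least one is nonzero.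
    have hne : e χ ≠ e 0 := fun h => hχ (e.injective h)
    by_cases h0 : e 0 = 0
    · refine ⟨(e χ).hom, fun h => hne ?_⟩
      rw [h0]
      exact ModuleCat.hom_ext h
    · exact ⟨(e 0).hom, fun h => h0 (ModuleCat.hom_ext h)⟩

end Duality

/-! ### Indecomposable injective hulls of uniserial modules. -/

section Hull

variable {Λ : Type u} [Ring Λ]

theorem Injective.of_retract {I D : Type u} [AddCommGroup I] [Module Λ I] [AddCommGroup D]
    [Module Λ D] [Module.Injective Λ D] (i : I →ₗ[Λ] D) (q : D →ₗ[Λ] I)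
    (hqi : q ∘ₗ i = LinearMap.id) : Module.Injective Λ I := ⟨fun X Y _ _ _ _ f hf g => by
  obtain ⟨h, hh⟩ := Module.Injective.extension_property Λ D X Y f hf (i ∘ₗ g)
  refine ⟨q ∘ₗ h, fun x => ?_⟩
  have h1 : h (f x) = i (g x) := LinearMap.congr_fun hh x
  simpa [h1] using LinearMap.congr_fun hqi (g x)⟩

/-- A uniserial module which embeds in an injective module of finite length embeds in an
indecomposable one. -/
theorem IsUniserial.exists_embedding_indecomposable [IsArtinianRing Λ] {M D : Type u}
    [AddCommGroup M] [Module Λ M] [Nontrivial M] (hM : IsUniserial Λ M) [AddCommGroup D]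
    [Module Λ D] [Module.Finite Λ D] [Module.Injective Λ D] (f : M →ₗ[Λ] D)
    (hf : Function.Injective f) :
    ∃ I : ModuleCat.{u} Λ, Module.Finite Λ I ∧ Module.Injective Λ I ∧ IsIndecomposable Λ I ∧
      ∃ g : M →ₗ[Λ] I, Function.Injective g := by
  let 𝒮 : Set (Submodule Λ D) := {I | (∃ q : D →ₗ[Λ] I, q ∘ₗ I.subtype = LinearMap.id) ∧
    ∃ g : M →ₗ[Λ] I, Function.Injective g}
  have hmem : ∀ (A : Type u) [AddCommGroup A] [Module Λ A] (i : A →ₗ[Λ] D) (q : D →ₗ[Λ] A)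
      (g : M →ₗ[Λ] A), q ∘ₗ i = LinearMap.id → Function.Injective g →
        LinearMap.range i ∈ 𝒮 := fun A _ _ i q g hqi hg => by
    have hi : Function.Injective i := fun x y hxy => by
      simpa [hxy] using (LinearMap.congr_fun hqi x).symm.trans
        ((congrArg q hxy).trans (LinearMap.congr_fun hqi y))
    let e := LinearEquiv.ofInjective i hi
    refine ⟨⟨e.toLinearMap ∘ₗ q, ?_⟩, e.toLinearMap ∘ₗ g, e.injective.comp hg⟩
    ext ⟨_, x, rfl⟩
    simpa [e] using congrArg i (LinearMap.congr_fun hqi x)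
  -- Take a minimal summand of `D` receiving an embedding of `M`. If it splits, the kernels of the
  -- two components of `g` meet in zero, so by uniseriality one component is already injective,
  -- against minimality unless the other summand is zero.
  obtain ⟨I, ⟨⟨q, hq⟩, g, hg⟩, hmin⟩ := wellFounded_lt.has_min 𝒮
    ⟨_, hmem D LinearMap.id LinearMap.id f rfl hf⟩
  have key : ∀ (A B : Submodule Λ I) (hAB : IsCompl A B),
      LinearMap.ker (A.projectionOnto B hAB ∘ₗ g) = ⊥ → B = ⊥ := fun A B hAB hk => by
    have h1 := hmem A (I.subtype ∘ₗ A.subtype) (A.projectionOnto B hAB ∘ₗ q) _ (by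
      ext x
      have h2 : q (x : I) = x := LinearMap.congr_fun hq x
      simp [h2]) (LinearMap.ker_eq_bot.1 hk)
    have h2 : A = ⊤ := by
      rw [eq_top_iff]
      intro x _
      by_contra hx
      refine hmin _ h1 (SetLike.lt_iff_le_and_exists.2 ⟨?_, (x : D), x.2, ?_⟩)
      · rintro _ ⟨y, rfl⟩
        exact y.1.2
      · rintro ⟨y, hy⟩
        exact hx ((Subtype.ext hy : (y : I) = x) ▸ y.2)
    simpa [h2] using hAB.inf_eq_bot
  refine ⟨ModuleCat.of Λ I, inferInstanceAs (Module.Finite Λ I), Injective.of_retract _ q hq,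
    ⟨hg.nontrivial, fun A B hAB => ?_⟩, g, hg⟩
  have hinf : LinearMap.ker (A.projectionOnto B hAB ∘ₗ g) ⊓
      LinearMap.ker (B.projectionOnto A hAB.symm ∘ₗ g) = ⊥ := by
    rw [eq_bot_iff]
    rintro x ⟨hxA, hxB⟩
    have h1 : g x ∈ B := (Submodule.projectionOnto_apply_eq_zero_iff hAB).1 hxA
    have h2 : g x ∈ A := (Submodule.projectionOnto_apply_eq_zero_iff hAB.symm).1 hxB
    have h3 : g x = 0 := Submodule.disjoint_def.1 hAB.disjoint _ h2 h1
    exact hg (h3.trans (map_zero g).symm)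
  rcases hM (LinearMap.ker (A.projectionOnto B hAB ∘ₗ g))
    (LinearMap.ker (B.projectionOnto A hAB.symm ∘ₗ g)) with h | h
  · exact .inr (key A B hAB (by rwa [inf_eq_left.2 h] at hinf))
  · exact .inl (key B A hAB.symm (by rwa [inf_eq_right.2 h] at hinf))

/-- A uniserial module of finite length embeds in an indecomposable injective module. -/
theorem IsMinimalInjectiveCogenerator.exists_embedding {k : Type u} [CommRing k]
    [IsArtinianRing k] [Algebra k Λ] [Module.Finite k Λ] {E : Type u} [AddCommGroup E] [Module k E]
    (hE : IsMinimalInjectiveCogenerator k E) {M : Type u} [AddCommGroup M] [Module Λ M]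
    [Nontrivial M] [Module.Finite Λ M] (hM : IsUniserial Λ M) :
    ∃ I : ModuleCat.{u} Λ, Module.Finite Λ I ∧ Module.Injective Λ I ∧ IsIndecomposable Λ I ∧
      ∃ g : M →ₗ[Λ] I, Function.Injective g := by
  have : IsArtinianRing Λ := IsArtinianRing.of_finite k Λ
  obtain ⟨D, hD1, hD2, hD⟩ := hE.exists_injective_cogenerator (Λ := Λ)
  obtain ⟨S, hS, -⟩ := (eq_bot_or_exists_atom_le (⊤ : Submodule Λ M)).resolve_left top_ne_bot
  have hSs : IsSimpleModule Λ S := isSimpleModule_iff_isAtom.2 hS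
  have := IsSimpleModule.nontrivial Λ S
  obtain ⟨f, hf⟩ := hD S
  obtain ⟨g, hg⟩ := Module.Injective.extension_property Λ D S M S.subtype
    S.subtype_injective f
  refine hM.exists_embedding_indecomposable g (LinearMap.ker_eq_bot.1 ?_)
  have hfi := (LinearMap.injective_or_eq_zero f).resolve_right hf
  have hinf : S ⊓ LinearMap.ker g = ⊥ := by
    rw [eq_bot_iff]
    rintro x ⟨hx, hgx⟩
    have h1 : g x = f ⟨x, hx⟩ := LinearMap.congr_fun hg ⟨x, hx⟩
    have h2 : f ⟨x, hx⟩ = f 0 := by rw [← h1, map_zero]; exact hgx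
    exact congrArg Subtype.val (hfi h2)
  rcases hM S (LinearMap.ker g) with h | h
  · exact absurd (by rwa [inf_eq_left.2 h] at hinf) hS.1
  · rwa [inf_eq_right.2 h] at hinf

end Hull

end NakayamaTilting

namespace NakayamaTilting

theorem Injective.of_equiv {Λ I D : Type u} [Ring Λ] [AddCommGroup I] [Module Λ I]
    [AddCommGroup D] [Module Λ D] [Module.Injective Λ D] (e : I ≃ₗ[Λ] D) : Module.Injective Λ I :=
  Injective.of_retract e.toLinearMap e.symm.toLinearMap (by ext; simp)

/-- An internal direct sum decomposition as an isomorphism with a product. -/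
noncomputable def equivPiOfIsInternal {Λ M : Type*} [Ring Λ] [AddCommGroup M] [Module Λ M] {m : ℕ}
    {X : Fin m → Submodule Λ M} (hX : DirectSum.IsInternal X) : M ≃ₗ[Λ] (∀ s, X s) :=
  (LinearEquiv.ofBijective (DirectSum.coeLinearMap X) hX).symm ≪≫ₗ
    DirectSum.linearEquivFunOnFintype Λ (Fin m) (fun s => X s)

theorem exists_retract_of_equiv_pi {Λ M : Type*} [Ring Λ] [AddCommGroup M] [Module Λ M]
    {ι : Type*} {Z : ι → Type*} [∀ s, AddCommGroup (Z s)] [∀ s, Module Λ (Z s)]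
    (e : M ≃ₗ[Λ] ∀ s, Z s) (s : ι) :
    ∃ (i : Z s →ₗ[Λ] M) (q : M →ₗ[Λ] Z s), q ∘ₗ i = LinearMap.id := by
  classical
  refine ⟨e.symm.toLinearMap ∘ₗ LinearMap.single Λ Z s, LinearMap.proj s ∘ₗ e.toLinearMap, ?_⟩
  ext x
  simp

/-! ### Consequences of the Kupisch conditions. -/

namespace IsKupischSeries

variable {k : Type u} [CommRing k] {Λ : Type u} [Ring Λ] [Algebra k Λ]
  {n : ℕ} [NeZero n] {P : ZMod n → ModuleCat.{u} Λ}

theorem nontrivial (hP : IsKupischSeries k Λ P) (i : ZMod n) : Nontrivial (P i) :=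
  (hP.indecomposable i).1

theorem uniserial (hP : IsKupischSeries k Λ P) (hNak : IsNakayama Λ) (i : ZMod n) :
    IsUniserial Λ (P i) :=
  hNak (P i) (hP.finite i) (hP.indecomposable i) (.inl (hP.projective i))

theorem eq_of_surjective (hP : IsKupischSeries k Λ P) {i j : ZMod n} (f : P i →ₗ[Λ] P j)
    (hf : Function.Surjective f) : i = j := by
  have := hP.projective j
  have := hP.nontrivial j
  exact hP.eq_of_iso i j ⟨LinearEquiv.ofBijective f
    (HasTrivialSummands.bijective_of_surjective (hP.indecomposable i).2 f hf)⟩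

theorem exists_retract_regular (hP : IsKupischSeries k Λ P) (hNak : IsNakayama Λ) (i : ZMod n) :
    ∃ (s : P i →ₗ[Λ] Λ) (p : Λ →ₗ[Λ] P i), p ∘ₗ s = LinearMap.id := by
  have := hP.projective i
  have := hP.finite i
  have := hP.nontrivial i
  have hU := hP.uniserial hNak i
  obtain ⟨x, hx⟩ := hU.exists_notMem_jacobson
  have hg : Function.Surjective (LinearMap.toSpanSingleton Λ (P i) x) :=
    hU.surjective_of_not_mem_jacobson _ (x := 1) (by simpa using hx)
  obtain ⟨s, hs⟩ := Module.projective_lifting_property _ LinearMap.id hg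
  exact ⟨s, _, hs⟩

theorem exists_equiv_pi (hP : IsKupischSeries k Λ P) (hbasic : IsBasicModule Λ Λ) :
    ∃ (m : ℕ) (σ : Fin m → ZMod n), Nonempty (Λ ≃ₗ[Λ] ∀ s, P (σ s)) := by
  obtain ⟨m, X, hX, hind, -⟩ := hbasic
  have key : ∀ s, ∃ j, Nonempty (X s ≃ₗ[Λ] P j) := fun s => by
    obtain ⟨i, q, hqi⟩ := exists_retract_of_equiv_pi (equivPiOfIsInternal hX) s
    exact hP.exists_iso (ModuleCat.of Λ (X s))
      (Module.Finite.of_surjective q fun x => ⟨i x, LinearMap.congr_fun hqi x⟩)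
      (Module.Projective.of_split i q hqi) (hind s)
  choose σ e using key
  exact ⟨m, σ, ⟨equivPiOfIsInternal hX ≪≫ₗ LinearEquiv.piCongrRight fun s => (e s).some⟩⟩

/-- A generator `x` of the local module `M` is a sum of images from the factors `P (σ s)` of `Λ`;
one of these lies outside the radical and so generates `M`. -/
theorem exists_surjective (hP : IsKupischSeries k Λ P) (hbasic : IsBasicModule Λ Λ) {M : Type u}
    [AddCommGroup M] [Module Λ M] [Module.Finite Λ M] [Nontrivial M] (hM : IsUniserial Λ M) :
    ∃ (j : ZMod n) (f : P j →ₗ[Λ] M), Function.Surjective f := by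
  classical
  obtain ⟨m, σ, ⟨e⟩⟩ := hP.exists_equiv_pi hbasic
  obtain ⟨x, hx⟩ := hM.exists_notMem_jacobson
  let h := LinearMap.toSpanSingleton Λ M x ∘ₗ e.symm.toLinearMap
  have hh : h (e 1) = x := by simp [h]
  obtain ⟨s, hs⟩ : ∃ s, h (Pi.single s (e 1 s)) ∉ Module.jacobson Λ M := by
    by_contra hcon
    push Not at hcon
    rw [← Finset.univ_sum_single (e 1), map_sum] at hh
    exact hx (hh ▸ Submodule.sum_mem _ fun s _ => hcon s)
  exact ⟨σ s, h ∘ₗ LinearMap.single Λ (fun s => P (σ s)) s,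
    hM.surjective_of_not_mem_jacobson _ (x := e 1 s) hs⟩

theorem eq_of_top_surjective (hP : IsKupischSeries k Λ P) (hNak : IsNakayama Λ) {i j : ZMod n}
    (f : P i →ₗ[Λ] Top Λ (P j)) (hf : Function.Surjective f) : i = j := by
  have := hP.projective i
  have := hP.nontrivial j
  have := hP.finite j
  obtain ⟨g, hg⟩ := Module.projective_lifting_property (Module.jacobson Λ (P j)).mkQ f
    (Submodule.mkQ_surjective _)
  exact hP.eq_of_surjective g ((hP.uniserial hNak j).surjective_of_top g (hg ▸ hf))

theorem eq_of_top_equiv (hP : IsKupischSeries k Λ P) (hNak : IsNakayama Λ) {i j : ZMod n}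
    (e : Top Λ (P i) ≃ₗ[Λ] Top Λ (P j)) : i = j :=
  hP.eq_of_top_surjective hNak (e.toLinearMap ∘ₗ (Module.jacobson Λ (P i)).mkQ)
    (e.surjective.comp (Submodule.mkQ_surjective _))

theorem length_eq (hP : IsKupischSeries k Λ P) (hNak : IsNakayama Λ) (i : ZMod n) :
    Module.length Λ (P i) = Module.length Λ (Module.jacobson Λ (P i)) + 1 := by
  have := hP.nontrivial i
  have := hP.finite i
  have := (hP.uniserial hNak i).isSimpleModule_top
  rw [Module.length_eq_add_of_exact (Module.jacobson Λ (P i)).subtype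
    (Module.jacobson Λ (P i)).mkQ (Submodule.subtype_injective _) (Submodule.mkQ_surjective _)
    (LinearMap.exact_subtype_mkQ _), Module.length_eq_one Λ (Top Λ (P i))]

/-- The radical of `P (i + 1)` is a quotient of `P i`. -/
theorem exists_surjective_jacobson [IsArtinianRing Λ] (hP : IsKupischSeries k Λ P)
    (hNak : IsNakayama Λ) (hbasic : IsBasicModule Λ Λ) (i : ZMod n)
    [hnt : Nontrivial (Module.jacobson Λ (P (i + 1)))] :
    ∃ f : P i →ₗ[Λ] Module.jacobson Λ (P (i + 1)), Function.Surjective f := by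
  -- The one excluded translate, at `i = 0` with `P 1` simple, would give `P 1` zero radical.
  have htr : i ≠ 0 ∨ Module.length Λ (P 1) ≠ 1 := by
    by_contra hcon
    push Not at hcon
    obtain ⟨rfl, h1⟩ := hcon
    have h2 := hP.length_eq hNak (0 + 1)
    have h3 := Module.length_pos (R := Λ) (M := Module.jacobson Λ (P (0 + 1)))
    rw [zero_add] at h2 h3
    rw [h1] at h2
    have h4 : Module.length Λ (Module.jacobson Λ (P 1)) + 1 = 0 + 1 := by rw [← h2, zero_add]
    exact h3.ne' (WithTop.add_right_cancel ENat.one_ne_top h4)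
  have := hP.finite (i + 1)
  have := hP.nontrivial (i + 1)
  have := hP.finite i
  have := hP.nontrivial i
  have hU := hP.uniserial hNak (i + 1)
  have hJ : IsUniserial Λ (Module.jacobson Λ (P (i + 1))) :=
    hU.of_injective _ (Submodule.subtype_injective _)
  obtain ⟨m, p, hp⟩ := hP.exists_surjective hbasic hJ
  suffices hmi : m = i by
    subst hmi
    exact ⟨p, hp⟩
  have := hP.projective m
  have := hP.finite m
  have := hP.nontrivial m
  have := hJ.isSimpleModule_top
  have := (hP.uniserial hNak i).isSimpleModule_top
  let ρ := (Module.jacobson Λ (Module.jacobson Λ (P (i + 1)))).mkQ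
  have hρ : Function.Surjective ρ := Submodule.mkQ_surjective _
  obtain ⟨s, g, hgs⟩ := hP.exists_retract_regular hNak m
  have hg : Function.Surjective g := fun z => ⟨s z, LinearMap.congr_fun hgs z⟩
  have hg1 : ∀ a, g a = a • g 1 := fun a => by rw [← map_smul, smul_eq_mul, mul_one]
  set x := g 1
  have hsx : s x • x = x := by rw [← hg1]; exact LinearMap.congr_fun hgs x
  have hρx : ρ (p x) ≠ 0 := fun h0 => by
    have := IsSimpleModule.nontrivial Λ (Top Λ (Module.jacobson Λ (P (i + 1))))
    obtain ⟨y, hy⟩ := exists_ne (0 : Top Λ (Module.jacobson Λ (P (i + 1))))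
    obtain ⟨a, rfl⟩ := ((hρ.comp hp).comp hg) y
    refine hy ?_
    simp only [Function.comp_apply]
    rw [hg1, map_smul, map_smul, h0, smul_zero]
  -- `s x` is the idempotent cutting out `P m`. It does not kill the top of `rad P (i+1)`, so it
  -- cannot kill the top of `P i`; this gives a nonzero map `P m → Top (P i)`, hence `m = i`.
  obtain ⟨y, hy⟩ : ∃ y : Top Λ (P i), s x • y ≠ 0 := by
    by_contra hcon
    push Not at hcon
    have h1 := (hP.translate i htr).smul_eq_zero hU ρ hρ (s x) hcon (ρ (p x))
    rw [← map_smul, ← map_smul, hsx] at h1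
    exact hρx h1
  let f := LinearMap.toSpanSingleton Λ (Top Λ (P i)) y ∘ₗ s
  refine hP.eq_of_top_surjective hNak f (LinearMap.surjective_of_ne_zero fun h0 => hy ?_)
  simpa [f] using LinearMap.congr_fun h0 x

/-- A uniserial module with radical `P i` is `P (i + 1)`. -/
theorem nonempty_equiv_of_isCoatom [IsArtinianRing Λ] (hP : IsKupischSeries k Λ P)
    (hNak : IsNakayama Λ) (hbasic : IsBasicModule Λ Λ) {V : Type u} [AddCommGroup V] [Module Λ V]
    [Module.Finite Λ V] (hV : IsUniserial Λ V) {A : Submodule Λ V} (hA : IsCoatom A) {i : ZMod n}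
    (e : A ≃ₗ[Λ] P i) :
    Nonempty (P (i + 1) ≃ₗ[Λ] V) ∧
      Module.length Λ (P (i + 1)) = Module.length Λ (P i) + 1 := by
  have := hP.nontrivial i
  have := hP.projective i
  have : Nontrivial A := e.toEquiv.nontrivial
  have : Nontrivial V := Subtype.coe_injective (p := (· ∈ A)) |>.nontrivial
  have : Module.Projective Λ A := Module.Projective.of_equiv e.symm
  obtain ⟨m, q, hq⟩ := hP.exists_surjective hbasic hV
  have := hP.finite m
  have hUm := hP.uniserial hNak m
  let B := A.comap q
  let qB : B →ₗ[Λ] A := q.restrict fun x hx => hx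
  have hqB : Function.Surjective qB := fun y => by
    obtain ⟨x, hx⟩ := hq y
    exact ⟨⟨x, by simp [B, hx]⟩, Subtype.ext hx⟩
  -- The preimage of `A` is uniserial and maps onto the projective module `A`, so it maps
  -- isomorphically. As it contains `ker q`, the cover `q` is itself an isomorphism.
  have hb : Function.Bijective qB :=
    (hUm.of_injective B.subtype B.subtype_injective).hasTrivialSummands.bijective_of_surjective
      qB hqB
  have hqi : Function.Injective q := by
    rw [← LinearMap.ker_eq_bot, LinearMap.ker_eq_bot']
    intro x hx
    have hxB : x ∈ B := by simp [B, hx]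
    exact congrArg Subtype.val (hb.1 (a₁ := ⟨x, hxB⟩) (a₂ := 0) (Subtype.ext (by simpa [qB] using hx)))
  let eq := LinearEquiv.ofBijective q ⟨hqi, hq⟩
  have hBc : IsCoatom B := (Submodule.orderIsoMapComap eq).symm.isCoatom_iff A |>.2 hA
  have hBJ := hUm.eq_jacobson hBc
  let eB : Module.jacobson Λ (P m) ≃ₗ[Λ] P i :=
    LinearEquiv.ofEq _ _ hBJ.symm ≪≫ₗ LinearEquiv.ofBijective qB hb ≪≫ₗ e
  obtain ⟨j, rfl⟩ : ∃ j, m = j + 1 := ⟨m - 1, by ring⟩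
  have : Nontrivial (Module.jacobson Λ (P (j + 1))) := eB.toEquiv.nontrivial
  obtain ⟨f, hf⟩ := hP.exists_surjective_jacobson hNak hbasic j
  have hji : j = i := hP.eq_of_surjective (eB.toLinearMap ∘ₗ f) (eB.surjective.comp hf)
  subst hji
  exact ⟨⟨eq⟩, by rw [hP.length_eq hNak, eB.length_eq]⟩

/-- If `P i` were proper in its uniserial injective hull, the submodule `V` covering it would be `P
(i+1)`, of length one more than `P i`. -/
theorem injective_of_length_le [IsArtinianRing k] [Module.Finite k Λ] (hP : IsKupischSeries k Λ P)
    (hNak : IsNakayama Λ) (hbasic : IsBasicModule Λ Λ) {i : ZMod n}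
    (hi : Module.length Λ (P (i + 1)) ≤ Module.length Λ (P i)) : Module.Injective Λ (P i) := by
  have : IsArtinianRing Λ := IsArtinianRing.of_finite k Λ
  have := hP.nontrivial i
  have := hP.finite i
  have := hP.projective i
  -- The injective envelope `E` of `k / rad k` is read off from any translate condition. If none is
  -- imposed, there is a single simple projective and `Λ` is semisimple.
  by_cases hE : ∃ j : ZMod n, j ≠ 0 ∨ Module.length Λ (P 1) ≠ 1
  · obtain ⟨j, hj⟩ := hE
    obtain ⟨E, Y, hE, -⟩ := hP.translate j hj
    obtain ⟨I, hI1, hI2, hI3, g, hg⟩ := hE.exists_embedding (Λ := Λ) (hP.uniserial hNak i)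
    have hIU : IsUniserial Λ I := hNak I hI1 hI3 (.inr hI2)
    by_cases hsurj : Function.Surjective g
    · exact Injective.of_equiv (LinearEquiv.ofBijective g ⟨hg, hsurj⟩)
    exfalso
    let U := LinearMap.range g
    have hU : U ≠ ⊤ := fun h => hsurj (LinearMap.range_eq_top.1 h)
    obtain ⟨V, hUV, -⟩ := exists_covBy_le_of_lt (lt_top_iff_ne_top.2 hU)
    have hVU : IsUniserial Λ V := hIU.of_injective V.subtype V.subtype_injective
    have hco : IsCoatom (U.submoduleOf V) := by
      rw [← isSimpleModule_iff_isCoatom]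
      exact (covBy_iff_quot_is_simple hUV.le).1 hUV
    let e : U.submoduleOf V ≃ₗ[Λ] P i :=
      Submodule.submoduleOfEquivOfLe hUV.le ≪≫ₗ (LinearEquiv.ofInjective g hg).symm
    have hlen := (hP.nonempty_equiv_of_isCoatom hNak hbasic hVU hco e).2
    have hfin : Module.length Λ (P i) ≠ ⊤ := Module.length_ne_top
    rw [hlen] at hi
    exact absurd hi (not_le.2 (ENat.lt_add_one_iff hfin |>.2 le_rfl))
  · push Not at hE
    obtain ⟨m, σ, ⟨e⟩⟩ := hP.exists_equiv_pi hbasic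
    have hs : ∀ j, IsSimpleModule Λ (P j) := fun j => by
      rw [← Module.length_eq_one_iff, ← (hE (j - 1)).2]
      congr 2
      all_goals rw [(hE j).1, (hE 1).1]
    have : IsSemisimpleModule Λ (∀ s, P (σ s)) := inferInstance
    have : IsSemisimpleRing Λ := IsSemisimpleModule.congr e
    exact Module.injective_of_isSemisimpleRing Λ (P i)

end IsKupischSeries

end NakayamaTilting

/-! ### Cosyzygies of the indecomposable projectives. -/

namespace NakayamaTilting

theorem IsUniserial.hasTrivialSummands_quotient {Λ M : Type u} [Ring Λ] [AddCommGroup M]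
    [Module Λ M] (h : IsUniserial Λ M) (A : Submodule Λ M) : HasTrivialSummands Λ (M ⧸ A) :=
  (h.of_surjective A.mkQ A.mkQ_surjective).hasTrivialSummands

theorem delta_eq_zero_iff {n : ℕ} [NeZero n] {c : ZMod n → ℕ} {i : ZMod n} : delta c i = 0 ↔ i ∈ setQ c := by
  obtain ⟨hmem, hmin⟩ := isLeast_delta c i
  constructor
  · intro h
    rw [h] at hmem
    simpa using hmem
  · intro h
    exact Nat.le_zero.1 (hmin (by simpa using h))

theorem notMem_setQ_of_mem_setP {n : ℕ} {c : ZMod n → ℕ} {i : ZMod n} (hi : i ∈ setP c) : i ∉ setQ c := fun h => by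
  have h1 : c (i + 1) = c i + 1 := hi
  have h2 : c (i + 1) ≤ c i := h
  omega

namespace IsKupischSeries

variable {k : Type u} [CommRing k] {Λ : Type u} [Ring Λ] [Algebra k Λ]
  {n : ℕ} [NeZero n] {P : ZMod n → ModuleCat.{u} Λ} {c : ZMod n → ℕ}

theorem mem_setP_of_notMem_setQ (hP : IsKupischSeries k Λ P)
    (hc : ∀ i, Module.length Λ (P i) = c i) {i : ZMod n} (hi : i ∉ setQ c) : i ∈ setP c := by
  have h1 := hP.length_le i
  rw [hc, hc] at h1
  have h2 : c (i + 1) ≤ c i + 1 := by exact_mod_cast h1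
  have h3 : ¬ c (i + 1) ≤ c i := hi
  change c (i + 1) = c i + 1
  omega

/-- The surjection `P i → rad P (i+1)` is between modules of equal finite length, so its kernel
vanishes. -/
theorem exists_injective_succ [IsArtinianRing Λ] (hP : IsKupischSeries k Λ P)
    (hNak : IsNakayama Λ) (hbasic : IsBasicModule Λ Λ) (hc : ∀ i, Module.length Λ (P i) = c i)
    {i : ZMod n} (hi : i ∈ setP c) : ∃ f : P i →ₗ[Λ] P (i + 1), Function.Injective f := by
  have := hP.nontrivial i
  have := hP.finite i
  have hi' : c (i + 1) = c i + 1 := hi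
  have h1 := hP.length_eq hNak (i + 1)
  rw [hc, hi', Nat.cast_add, Nat.cast_one] at h1
  have h2 : Module.length Λ (Module.jacobson Λ (P (i + 1))) = Module.length Λ (P i) := by
    rw [hc]
    exact (WithTop.add_right_cancel ENat.one_ne_top h1).symm
  have : Nontrivial (Module.jacobson Λ (P (i + 1))) := by
    rw [← Module.length_pos_iff (R := Λ), h2]
    exact Module.length_pos
  obtain ⟨f, hf⟩ := hP.exists_surjective_jacobson hNak hbasic i
  have h3 := Module.length_eq_add_of_exact (LinearMap.ker f).subtype f
    (Submodule.subtype_injective _) hf (LinearMap.exact_subtype_ker_map f)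
  have hfin : Module.length Λ (P i) ≠ ⊤ := Module.length_ne_top
  rw [h2] at h3
  have h4 : Module.length Λ (LinearMap.ker f) = 0 :=
    WithTop.add_right_cancel hfin (h3.symm.trans (zero_add _).symm)
  have h5 := Module.length_eq_zero_iff.1 h4
  exact ⟨(Submodule.subtype _) ∘ₗ f, (Submodule.subtype_injective _).comp
    (LinearMap.ker_eq_bot.1 ((Submodule.subsingleton_iff_eq_bot).1 h5))⟩

theorem exists_injective_add [IsArtinianRing Λ] (hP : IsKupischSeries k Λ P)
    (hNak : IsNakayama Λ) (hbasic : IsBasicModule Λ Λ) (hc : ∀ i, Module.length Λ (P i) = c i)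
    (i : ZMod n) (d : ℕ) (hd : ∀ t < d, i + (t : ZMod n) ∈ setP c) :
    c (i + d) = c i + d ∧ ∃ f : P i →ₗ[Λ] P (i + d), Function.Injective f := by
  induction d with
  | zero =>
    rw [Nat.cast_zero, add_zero]
    exact ⟨rfl, LinearMap.id, Function.injective_id⟩
  | succ d ih =>
    obtain ⟨h1, f, hf⟩ := ih fun t ht => hd t (by omega)
    obtain ⟨g, hg⟩ := hP.exists_injective_succ hNak hbasic hc (hd d (by omega))
    have h2 : c (i + d + 1) = c (i + d) + 1 := hd d (by omega)
    rw [Nat.cast_add, Nat.cast_one, ← add_assoc, h2, h1]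
    exact ⟨by omega, g ∘ₗ f, hg.comp hf⟩

/-- The cosyzygy of `P i` in its injective envelope. -/
theorem exists_cosyzygy [IsArtinianRing Λ] (hP : IsKupischSeries k Λ P)
    (hNak : IsNakayama Λ) (hbasic : IsBasicModule Λ Λ) (hc : ∀ i, Module.length Λ (P i) = c i)
    (i : ZMod n) :
    ∃ (j : ZMod n) (f : P i →ₗ[Λ] P j), j ∈ setQ c ∧ Function.Injective f ∧
      Module.length Λ (P j ⧸ LinearMap.range f) = delta c i := by
  obtain ⟨hmem, hmin⟩ := isLeast_delta c i
  obtain ⟨h1, f, hf⟩ := hP.exists_injective_add hNak hbasic hc i (delta c i) fun t ht =>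
    hP.mem_setP_of_notMem_setQ hc fun hQ => absurd (hmin hQ) (not_le.2 ht)
  refine ⟨_, f, hmem, hf, ?_⟩
  have h2 := Module.length_eq_add_of_exact f (LinearMap.range f).mkQ hf
    (Submodule.mkQ_surjective _) (LinearMap.exact_map_mkQ_range f)
  rw [hc, hc, h1, Nat.cast_add] at h2
  exact (WithTop.add_left_cancel (ENat.natCast_ne_top _) h2).symm

/-- The socle of a nonzero cokernel of an embedding `P i → P j` is the top of `P (i + 1)`. -/
theorem nonempty_socle_equiv [IsArtinianRing Λ] (hP : IsKupischSeries k Λ P)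
    (hNak : IsNakayama Λ) (hbasic : IsBasicModule Λ Λ) {i j : ZMod n} (f : P i →ₗ[Λ] P j)
    (hf : Function.Injective f) [hnt : Nontrivial (P j ⧸ LinearMap.range f)] :
    Nonempty (socle Λ (P j ⧸ LinearMap.range f) ≃ₗ[Λ] Top Λ (P (i + 1))) := by
  have := hP.finite j
  have hU := hP.uniserial hNak j
  have hT : IsUniserial Λ (P j ⧸ LinearMap.range f) :=
    hU.of_surjective _ (Submodule.mkQ_surjective _)
  obtain ⟨N, hN, -⟩ := (eq_bot_or_exists_atom_le
    (⊤ : Submodule Λ (P j ⧸ LinearMap.range f))).resolve_left top_ne_bot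
  have hNs : IsSimpleModule Λ N := isSimpleModule_iff_isAtom.2 hN
  -- `V` has the image of `P i` as maximal submodule, so it is `P (i+1)`, and `N ≅ V / P i` is its
  -- top.
  let V := N.comap (LinearMap.range f).mkQ
  have hV : IsUniserial Λ V := hU.of_injective V.subtype V.subtype_injective
  let φ : V →ₗ[Λ] N := (LinearMap.range f).mkQ.restrict fun x hx => hx
  have hφ : Function.Surjective φ := fun y => by
    obtain ⟨x, hx⟩ := Submodule.mkQ_surjective _ (y : P j ⧸ LinearMap.range f)
    exact ⟨⟨x, by simp only [V, Submodule.mem_comap]; rw [hx]; exact y.2⟩, Subtype.ext hx⟩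
  let eN : (V ⧸ LinearMap.ker φ) ≃ₗ[Λ] N := φ.quotKerEquivOfSurjective hφ
  have : IsSimpleModule Λ (V ⧸ LinearMap.ker φ) := IsSimpleModule.congr eN
  have hco : IsCoatom (LinearMap.ker φ) := isSimpleModule_iff_isCoatom.1 this
  have hker : LinearMap.ker φ = (LinearMap.range f).submoduleOf V := by
    ext x
    change φ x = 0 ↔ (x : P j) ∈ LinearMap.range f
    rw [← Submodule.Quotient.mk_eq_zero, ← Subtype.coe_inj]
    rfl
  have hle : LinearMap.range f ≤ V := fun x hx => by
    simp only [V, Submodule.mem_comap, Submodule.mkQ_apply]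
    rw [(Submodule.Quotient.mk_eq_zero _).2 hx]
    exact N.zero_mem
  let e : LinearMap.ker φ ≃ₗ[Λ] P i := LinearEquiv.ofEq _ _ hker ≪≫ₗ
    Submodule.submoduleOfEquivOfLe hle ≪≫ₗ (LinearEquiv.ofInjective f hf).symm
  obtain ⟨⟨e'⟩, -⟩ := hP.nonempty_equiv_of_isCoatom hNak hbasic hV hco e
  obtain ⟨e''⟩ := nonempty_top_equiv e'
  exact ⟨LinearEquiv.ofEq _ _ (hT.socle_eq hNs) ≪≫ₗ eN.symm ≪≫ₗ
    Submodule.quotEquivOfEq _ _ (hV.eq_jacobson hco) ≪≫ₗ e''.symm⟩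

/-- A projective cokernel would make the quotient map from the uniserial `P j` bijective,
contradicting `P i ≠ 0`. -/
theorem isEmpty_cosyzygy_equiv (hP : IsKupischSeries k Λ P) (hNak : IsNakayama Λ)
    {i j l : ZMod n} (f : P i →ₗ[Λ] P j) (hf : Function.Injective f) :
    IsEmpty ((P j ⧸ LinearMap.range f) ≃ₗ[Λ] P l) := by
  refine ⟨fun e => ?_⟩
  have := hP.nontrivial l
  have := hP.projective l
  have := hP.nontrivial i
  have hb := (hP.uniserial hNak j).hasTrivialSummands.bijective_of_surjective
    (e.toLinearMap ∘ₗ (LinearMap.range f).mkQ)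
    (e.surjective.comp (Submodule.mkQ_surjective _))
  obtain ⟨x, hx⟩ := exists_ne (0 : P i)
  refine hx (hf ((hb.1 (a₁ := f x) (a₂ := 0) ?_).trans (map_zero f).symm))
  simp

end IsKupischSeries

end NakayamaTilting

namespace NakayamaTilting

/-! ### Closure properties of `add T`. -/

section Add

variable {Λ : Type u} [Ring Λ] {X Y Z T : Type u} [AddCommGroup X] [Module Λ X] [AddCommGroup Y]
  [Module Λ Y] [AddCommGroup Z] [Module Λ Z] [AddCommGroup T] [Module Λ T]

theorem MemAdd.of_retract (h : MemAdd Λ Y T) (i : X →ₗ[Λ] Y) (q : Y →ₗ[Λ] X)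
    (hqi : q ∘ₗ i = LinearMap.id) : MemAdd Λ X T := by
  obtain ⟨m, j, p, hpj⟩ := h
  refine ⟨m, j ∘ₗ i, q ∘ₗ p, ?_⟩
  rw [LinearMap.comp_assoc, ← LinearMap.comp_assoc i j p, hpj, LinearMap.id_comp, hqi]

theorem MemAdd.of_equiv (h : MemAdd Λ Y T) (e : X ≃ₗ[Λ] Y) : MemAdd Λ X T :=
  h.of_retract e.toLinearMap e.symm.toLinearMap (by ext; simp)

theorem MemAdd.of_retract_fintype {ι : Type*} [Fintype ι] (i : X →ₗ[Λ] (ι → T))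
    (q : (ι → T) →ₗ[Λ] X) (hqi : q ∘ₗ i = LinearMap.id) : MemAdd Λ X T := by
  let e := LinearEquiv.funCongrLeft Λ T (Fintype.equivFin ι).symm
  refine ⟨Fintype.card ι, e.toLinearMap ∘ₗ i, q ∘ₗ e.symm.toLinearMap, ?_⟩
  ext x
  simpa using LinearMap.congr_fun hqi x

theorem MemAdd.of_retract_self (i : X →ₗ[Λ] T) (q : T →ₗ[Λ] X)
    (hqi : q ∘ₗ i = LinearMap.id) : MemAdd Λ X T :=
  .of_retract_fintype (ι := Unit) (LinearMap.pi fun _ => i) (q ∘ₗ LinearMap.proj ())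
    (by ext x; simpa using LinearMap.congr_fun hqi x)

theorem MemAdd.pi {ι : Type} [Fintype ι] {Z : ι → Type u} [∀ s, AddCommGroup (Z s)]
    [∀ s, Module Λ (Z s)] (h : ∀ s, MemAdd Λ (Z s) T) : MemAdd Λ (∀ s, Z s) T := by
  choose m j p hpj using h
  let e := LinearEquiv.piCurry Λ (fun (s : ι) (_ : Fin (m s)) => T)
  refine .of_retract_fintype (ι := Σ s, Fin (m s)) (e.symm.toLinearMap ∘ₗ LinearMap.piMap j)
    (LinearMap.piMap p ∘ₗ e.toLinearMap) ?_
  refine LinearMap.ext fun x => funext fun s => ?_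
  simpa using LinearMap.congr_fun (hpj s) (x s)

theorem MemAdd.of_add_eq_id (hX : MemAdd Λ X T) (hY : MemAdd Λ Y T) (i : Z →ₗ[Λ] X)
    (q : X →ₗ[Λ] Z) (i' : Z →ₗ[Λ] Y) (q' : Y →ₗ[Λ] Z) (h : q ∘ₗ i + q' ∘ₗ i' = LinearMap.id) :
    MemAdd Λ Z T := by
  obtain ⟨m, j, p, hpj⟩ := hX
  obtain ⟨m', j', p', hpj'⟩ := hY
  let e := LinearEquiv.sumArrowLequivProdArrow (Fin m) (Fin m') Λ T
  refine .of_retract_fintype (ι := Fin m ⊕ Fin m')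
    (e.symm.toLinearMap ∘ₗ ((j ∘ₗ i).prod (j' ∘ₗ i')))
    ((q ∘ₗ p).coprod (q' ∘ₗ p') ∘ₗ e.toLinearMap) ?_
  ext x
  have h1 : p (j (i x)) = i x := LinearMap.congr_fun hpj _
  have h2 : p' (j' (i' x)) = i' x := LinearMap.congr_fun hpj' _
  simpa [h1, h2] using LinearMap.congr_fun h x

/-- An indecomposable module of finite length in `add (∏ Z s)` is isomorphic to one of the
modules `Z s` when these have no proper summands. -/
theorem MemAdd.exists_equiv [IsNoetherian Λ X] [IsArtinian Λ X] (hX : IsIndecomposable Λ X)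
    {ι : Type*} [Fintype ι] {Z : ι → Type u} [∀ s, AddCommGroup (Z s)]
    [∀ s, Module Λ (Z s)] (hZ : ∀ s, HasTrivialSummands Λ (Z s)) (e : T ≃ₗ[Λ] ∀ s, Z s)
    (h : MemAdd Λ X T) : ∃ s, Nonempty (X ≃ₗ[Λ] Z s) := by
  have := hX.1
  obtain ⟨m, j, p, hpj⟩ := h
  let e' : (Fin m → T) ≃ₗ[Λ] (∀ x : (Σ _ : Fin m, ι), Z x.2) :=
    (LinearEquiv.piCongrRight fun _ => e) ≪≫ₗ
      (LinearEquiv.piCurry Λ (fun (_ : Fin m) (s : ι) => Z s)).symm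
  obtain ⟨s, hs⟩ := HasTrivialSummands.exists_equiv_of_retract_pi hX.2
    (Z := fun x : (Σ _ : Fin m, ι) => Z x.2) (fun x => hZ x.2)
    (e'.toLinearMap ∘ₗ j) (p ∘ₗ e'.symm.toLinearMap) (by
      ext x
      simpa using LinearMap.congr_fun hpj x)
  exact ⟨s.2, hs⟩

end Add

/-! ### Quotients of injective modules. -/

section InjectiveQuotient

variable {Λ : Type u} [Ring Λ]

/-- `M` is a quotient of an injective module. -/
def IsQuotientOfInjective (Λ : Type u) [Ring Λ] (M : Type u) [AddCommGroup M] [Module Λ M] :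
    Prop :=
  ∃ (J : ModuleCat.{u} Λ) (p : J →ₗ[Λ] M), Module.Injective Λ J ∧ Function.Surjective p

variable {M N K B : Type u} [AddCommGroup M] [Module Λ M] [AddCommGroup N] [Module Λ N]
  [AddCommGroup K] [Module Λ K] [AddCommGroup B] [Module Λ B]

theorem IsQuotientOfInjective.of_surjective (h : IsQuotientOfInjective Λ M) (f : M →ₗ[Λ] N)
    (hf : Function.Surjective f) : IsQuotientOfInjective Λ N := by
  obtain ⟨J, p, hJ, hp⟩ := h
  exact ⟨J, f ∘ₗ p, hJ, hf.comp hp⟩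

theorem IsQuotientOfInjective.pow (h : IsQuotientOfInjective Λ M) (m : ℕ) :
    IsQuotientOfInjective Λ (Fin m → M) := by
  obtain ⟨J, p, hJ, hp⟩ := h
  exact ⟨ModuleCat.of Λ (Fin m → J), p.compLeft (Fin m), Module.Injective.pi Λ _,
    fun y => ⟨fun s => (hp (y s)).choose, funext fun s => (hp (y s)).choose_spec⟩⟩

theorem IsQuotientOfInjective.of_memAdd (h : IsQuotientOfInjective Λ M) (hN : MemAdd Λ N M) :
    IsQuotientOfInjective Λ N := by
  obtain ⟨m, j, p, hpj⟩ := hN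
  exact (h.pow m).of_surjective p fun x => ⟨j x, LinearMap.congr_fun hpj x⟩

theorem MemC.isQuotientOfInjective (h : MemC Λ M) : IsQuotientOfInjective Λ M := by
  obtain ⟨-, t, Q, hQ, ⟨a, p, hp⟩, -⟩ := h
  have := hQ.injective
  have : Module.Injective Λ (∀ i, Q i) := Module.Injective.pi Λ _
  have : Module.Injective Λ (⨁ i, Q i) :=
    Injective.of_equiv (DirectSum.linearEquivFunOnFintype Λ (Fin t) fun i => Q i)
  exact ⟨ModuleCat.of Λ (Fin a → ⨁ i, Q i), p, Module.Injective.pi Λ _, hp⟩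

/-- Maps from a projective module to a quotient of an injective module extend along injections. -/
theorem IsQuotientOfInjective.exists_extension (h : IsQuotientOfInjective Λ M)
    [Module.Projective Λ K] (f : K →ₗ[Λ] B) (hf : Function.Injective f) (g : K →ₗ[Λ] M) :
    ∃ g' : B →ₗ[Λ] M, g' ∘ₗ f = g := by
  obtain ⟨J, p, hJ, hp⟩ := h
  obtain ⟨l, hl⟩ := Module.projective_lifting_property p g hp
  obtain ⟨l', hl'⟩ := Module.Injective.extension_property Λ J K B f hf l
  exact ⟨p ∘ₗ l', by rw [LinearMap.comp_assoc, hl', hl]⟩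

end InjectiveQuotient

/-! ### Comparing `add T` with injective coresolutions. -/

section Tilting

variable {Λ : Type u} [Ring Λ] {T : Type u} [AddCommGroup T] [Module Λ T]

open CategoryTheory in
theorem projective_ker (hpd : HasProjectiveDimensionLE (ModuleCat.of Λ T) 1) {F : Type u}
    [AddCommGroup F] [Module Λ F] [Module.Projective Λ F] (ρ : F →ₗ[Λ] T)
    (hρ : Function.Surjective ρ) : Module.Projective Λ (LinearMap.ker ρ) := by
  have hS := LinearMap.shortExact_shortComplexKer hρ
  have : Projective (ModuleCat.of Λ F) := (IsProjective.iff_projective F).1 inferInstance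
  rw [IsProjective.iff_projective, projective_iff_hasProjectiveDimensionLT_one]
  exact hS.hasProjectiveDimensionLT_X₁ 1
    (projective_iff_hasProjectiveDimensionLT_one.1 this) hpd

theorem exists_retract_free {K : Type u} [AddCommGroup K] [Module Λ K] [Module.Finite Λ K]
    [Module.Projective Λ K] :
    ∃ (m : ℕ) (s : K →ₗ[Λ] (Fin m → Λ)) (p : (Fin m → Λ) →ₗ[Λ] K), p ∘ₗ s = LinearMap.id := by
  obtain ⟨m, p, hp⟩ := Module.Finite.exists_fin' Λ K
  obtain ⟨s, hs⟩ := Module.projective_lifting_property p LinearMap.id hp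
  exact ⟨m, s, p, hs⟩

/-- Projective-injective modules belong to `add T`. -/
theorem IsTilting.memAdd_of_injective (hT : IsTilting Λ T) {X : Type u} [AddCommGroup X]
    [Module Λ X] [Module.Finite Λ X] [Module.Projective Λ X] [Module.Injective Λ X] :
    MemAdd Λ X T := by
  obtain ⟨T₀, T₁, f, g, ⟨a, j, q, hqj⟩, -, hf, -, -⟩ := hT.exists_coresolution
  obtain ⟨m, s, p, hps⟩ := exists_retract_free (Λ := Λ) (K := X)
  have hj : Function.Injective j := Function.LeftInverse.injective (LinearMap.congr_fun hqj)
  have hs : Function.Injective s := Function.LeftInverse.injective (LinearMap.congr_fun hps)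
  -- `X` embeds in a power of `Λ`, hence of `T`, and injectivity splits the embedding.
  let i : X →ₗ[Λ] (Fin m → Fin a → T) := (j ∘ₗ f).compLeft (Fin m) ∘ₗ s
  have hi : Function.Injective i := (Function.Injective.comp_left (hj.comp hf)).comp hs
  obtain ⟨r, hr⟩ := Module.Injective.extension_property Λ X X _ i hi LinearMap.id
  have hpow : MemAdd Λ (Fin m → Fin a → T) T :=
    .pi fun _ => .pi fun _ => .of_retract_self LinearMap.id LinearMap.id rfl
  exact hpow.of_retract i r hr

/-- The cokernel of an embedding of a direct summand of `Λ` in a projective-injective module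
belongs to `add T`. -/
theorem IsTilting.memAdd_of_exact (hT : IsTilting Λ T) (hG : IsQuotientOfInjective Λ T)
    {K B C : Type u} [AddCommGroup K] [Module Λ K] [AddCommGroup B] [Module Λ B] [AddCommGroup C]
    [Module Λ C] [Module.Finite Λ B] [Module.Projective Λ B] [Module.Injective Λ B]
    [Module.Projective Λ K] (s : K →ₗ[Λ] Λ) (p : Λ →ₗ[Λ] K) (hps : p ∘ₗ s = LinearMap.id)
    (f : K →ₗ[Λ] B) (g : B →ₗ[Λ] C) (hf : Function.Injective f) (hfg : Function.Exact f g)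
    (hg : Function.Surjective g) : MemAdd Λ C T := by
  obtain ⟨T₀, T₁, f', g', h₀, h₁, hf', hfg', hg'⟩ := hT.exists_coresolution
  obtain ⟨v, hv⟩ := (hG.of_memAdd h₀).exists_extension f hf (f' ∘ₗ s)
  obtain ⟨w, hw⟩ := Module.Injective.extension_property Λ B _ _ f' hf' (f ∘ₗ p)
  obtain ⟨i, q, r, h⟩ := exists_retract_of_exact f g hfg hg f' g' hfg' hg' s p hps v w hv hw
  exact h₁.of_add_eq_id hT.memAdd_of_injective i q r g h

/-- If `Λ` embeds in an injective module `B` with cokernel `C`, then a module of projective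
dimension at most one which is a quotient of an injective module belongs to `add Z` as soon as
`B` and `C` do. -/
theorem memAdd_of_projectiveDimension_le_one [IsNoetherianRing Λ] [Module.Finite Λ T]
    (hpd : CategoryTheory.HasProjectiveDimensionLE (ModuleCat.of Λ T) 1)
    (hG : IsQuotientOfInjective Λ T) {B C Z : Type u} [AddCommGroup B] [Module Λ B]
    [AddCommGroup C] [Module Λ C] [AddCommGroup Z] [Module Λ Z] [Module.Injective Λ B]
    (f : Λ →ₗ[Λ] B) (g : B →ₗ[Λ] C) (hf : Function.Injective f) (hfg : Function.Exact f g)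
    (hg : Function.Surjective g) (hB : MemAdd Λ B Z) (hC : MemAdd Λ C Z) : MemAdd Λ T Z := by
  obtain ⟨m, ρ, hρ⟩ := Module.Finite.exists_fin' Λ T
  have := projective_ker hpd ρ hρ
  obtain ⟨m', s, p, hps⟩ := exists_retract_free (Λ := Λ) (K := LinearMap.ker ρ)
  have hinj : ∀ N, Function.Injective (f.compLeft (Fin N)) := fun N => hf.comp_left
  have : ∀ N, Module.Injective Λ (Fin N → B) := fun N => Module.Injective.pi Λ _
  have hexact : ∀ N, Function.Exact (f.compLeft (Fin N)) (g.compLeft (Fin N)) := fun N y => by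
    constructor
    · intro hy
      have h1 : ∀ s, ∃ x, f x = y s := fun s => (hfg (y s)).1 (congrFun hy s)
      choose x hx using h1
      exact ⟨x, funext hx⟩
    · rintro ⟨x, rfl⟩
      exact funext fun s => hfg.apply_apply_eq_zero (x s)
  have hsurj : ∀ N, Function.Surjective (g.compLeft (Fin N)) := fun N => hg.comp_left
  let β := f.compLeft (Fin m)
  let κ := β ∘ₗ (LinearMap.ker ρ).subtype
  have hκ : Function.Injective κ := (hinj m).comp (Submodule.subtype_injective _)
  let π := (LinearMap.range κ).mkQ
  have hπ : Function.Surjective π := Submodule.mkQ_surjective _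
  have hκπ : Function.Exact κ π := LinearMap.exact_map_mkQ_range κ
  obtain ⟨v, hv⟩ := Module.Injective.extension_property Λ _ _ _ κ hκ (f.compLeft (Fin m') ∘ₗ s)
  obtain ⟨w, hw⟩ := Module.Injective.extension_property Λ _ _ _ (f.compLeft (Fin m')) (hinj m')
    (κ ∘ₗ p)
  -- `K = ker ρ` is a retract of `Λ^m'`, so `B^m / K` is a retract of `C^m' × B^m`.
  obtain ⟨i, q, r, h⟩ := exists_retract_of_exact κ π hκπ hπ _ _ (hexact m') (hsurj m') s p hps
    v w hv hw
  have hPO : MemAdd Λ ((Fin m → B) ⧸ LinearMap.range κ) Z :=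
    (MemAdd.pi fun _ => hC).of_add_eq_id (MemAdd.pi fun _ => hB) i q r π h
  -- `T = Λ^m / K` maps into `B^m / K`. The extension of `ρ` to `B^m` kills `K` and induces a
  -- retraction back onto `T`.
  obtain ⟨l, hl⟩ := hG.exists_extension β (hinj m) ρ
  obtain ⟨l', hl'⟩ := exists_factor_of_exact κ π hκπ hπ l (by
    ext x
    have h1 : l (β (x : Fin m → Λ)) = ρ x := LinearMap.congr_fun hl _
    exact h1.trans x.2)
  obtain ⟨t, ht⟩ := exists_factor_of_exact (LinearMap.ker ρ).subtype ρ
    (LinearMap.exact_subtype_ker_map ρ) hρ (π ∘ₗ β) (by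
      rw [LinearMap.comp_assoc]
      exact hκπ.linearMap_comp_eq_zero)
  refine hPO.of_retract t l' ?_
  ext x
  obtain ⟨y, rfl⟩ := hρ x
  have h1 : t (ρ y) = π (β y) := LinearMap.congr_fun ht y
  have h2 : l' (π (β y)) = l (β y) := LinearMap.congr_fun hl' _
  have h3 : l (β y) = ρ y := LinearMap.congr_fun hl y
  simp [h1, h2, h3]

end Tilting

/-- Two finite families of pairwise non-isomorphic modules with the same isomorphism classes have
isomorphic products. -/
theorem nonempty_pi_equiv {Λ : Type*} [Ring Λ] {ι κ : Type*} {X : ι → Type*} {Y : κ → Type*}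
    [∀ s, AddCommGroup (X s)] [∀ s, Module Λ (X s)] [∀ a, AddCommGroup (Y a)]
    [∀ a, Module Λ (Y a)] (hX : ∀ s t, Nonempty (X s ≃ₗ[Λ] X t) → s = t)
    (hY : ∀ a b, Nonempty (Y a ≃ₗ[Λ] Y b) → a = b) (hXY : ∀ s, ∃ a, Nonempty (X s ≃ₗ[Λ] Y a))
    (hYX : ∀ a, ∃ s, Nonempty (Y a ≃ₗ[Λ] X s)) : Nonempty ((∀ s, X s) ≃ₗ[Λ] ∀ a, Y a) := by
  choose φ e using hXY
  have hφ : Function.Bijective φ := by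
    constructor
    · intro s t hst
      refine hX s t ⟨(e s).some ≪≫ₗ ?_⟩
      rw [hst]
      exact (e t).some.symm
    · intro a
      obtain ⟨s, ⟨e'⟩⟩ := hYX a
      exact ⟨s, (hY _ _ ⟨e' ≪≫ₗ (e s).some⟩).symm⟩
  exact ⟨(LinearEquiv.piCongrRight fun s => (e s).some) ≪≫ₗ
    LinearEquiv.piCongrLeft Λ (fun a => Y a) (Equiv.ofBijective φ hφ)⟩

end NakayamaTilting

/-! ### Matching the indecomposable summands. -/

namespace NakayamaTilting

/-- A tilting module in `𝒞_Λ` is the sum of the projective-injective modules and of the cosyzygies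
of the other indecomposable projective modules. -/
theorem IsTilting.exists_decomposition {k : Type u} [CommRing k] [IsArtinianRing k]
    {Λ : Type u} [Ring Λ] [Algebra k Λ] [Module.Finite k Λ]
    (hNak : IsNakayama Λ)
    (hbasic : IsBasicModule Λ Λ)
    {n : ℕ} [NeZero n] (P : ZMod n → ModuleCat.{u} Λ)
    (hP : IsKupischSeries k Λ P)
    (c : ZMod n → ℕ) (hc : ∀ i, Module.length Λ (P i) = c i)
    (TC : ModuleCat.{u} Λ) (hTC : IsTilting Λ TC)
    (hmem : MemC Λ TC) :
    ∃ T : setP c → ModuleCat.{u} Λ,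
      (∀ i, IsUniserial Λ (T i) ∧
        Nonempty (socle Λ (T i) ≃ₗ[Λ]
          Top Λ (P ((i : ZMod n) + 1))) ∧
        Module.length Λ (T i) = delta c (i : ZMod n)) ∧
      Nonempty (TC ≃ₗ[Λ]
        (⨁ j : setQ c, P (j : ZMod n)) ×
          (⨁ i : setP c, T i)) := by
  classical
  have hArt : IsArtinianRing Λ := IsArtinianRing.of_finite k Λ
  have := hTC.finite
  have hG := hmem.isQuotientOfInjective
  choose j f hj hf hlen using fun i => hP.exists_cosyzygy hNak hbasic hc i
  let W : ZMod n → ModuleCat.{u} Λ := fun i => ModuleCat.of Λ (P (j i) ⧸ LinearMap.range (f i))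
  have hWlen : ∀ i, Module.length Λ (W i) = delta c i := hlen
  have hWtriv : ∀ i, HasTrivialSummands Λ (W i) := fun i =>
    (hP.uniserial hNak (j i)).hasTrivialSummands_quotient _
  have hWuni : ∀ i, IsUniserial Λ (W i) := fun i =>
    (hP.uniserial hNak (j i)).of_surjective _ (Submodule.mkQ_surjective (LinearMap.range (f i)))
  have hWnt : ∀ i ∈ setP c, Nontrivial (W i) := fun i hi => by
    rw [← Module.length_pos_iff (R := Λ), hWlen, Nat.cast_pos, Nat.pos_iff_ne_zero]
    exact fun h0 => notMem_setQ_of_mem_setP hi (delta_eq_zero_iff.1 h0)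
  have hWP : ∀ i, Nontrivial (W i) → i ∈ setP c := fun i hi => by
    refine hP.mem_setP_of_notMem_setQ hc fun hQ => ?_
    rw [← Module.length_pos_iff (R := Λ), hWlen, delta_eq_zero_iff.2 hQ] at hi
    exact absurd hi (by simp)
  have hsoc : ∀ i ∈ setP c, Nonempty (socle Λ (W i) ≃ₗ[Λ] Top Λ (P (i + 1))) := fun i hi =>
    have : Nontrivial (P (j i) ⧸ LinearMap.range (f i)) := hWnt i hi
    hP.nonempty_socle_equiv hNak hbasic (f i) (hf i)
  -- The socle of `W a` recovers the index `a + 1`.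
  have hWiso : ∀ a ∈ setP c, ∀ b ∈ setP c, (W a ≃ₗ[Λ] W b) → a = b := fun a ha b hb e => by
    obtain ⟨ea⟩ := hsoc a ha
    obtain ⟨eb⟩ := hsoc b hb
    obtain ⟨e'⟩ := nonempty_socle_equiv_socle e
    exact add_right_cancel (hP.eq_of_top_equiv hNak ((ea.symm.trans e').trans eb))
  refine ⟨fun i => W i, fun i => ⟨hWuni i, hsoc i i.2, hWlen i⟩, ?_⟩
  have := hP.finite
  have := hP.projective
  have hinj : ∀ i ∈ setQ c, Module.Injective Λ (P i) := fun i hi =>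
    hP.injective_of_length_le hNak hbasic (by
      rw [hc, hc]
      exact_mod_cast (show c (i + 1) ≤ c i from hi))
  have hWfin : ∀ i, Module.Finite Λ (W i) := fun i =>
    inferInstanceAs (Module.Finite Λ (P (j i) ⧸ LinearMap.range (f i)))
  obtain ⟨m, X, hX, hXind, hXiso⟩ := hTC.basic
  let Y : setQ c ⊕ setP c → ModuleCat.{u} Λ := Sum.elim (fun i => P i) fun i => W i
  have hYfin : ∀ a, Module.Finite Λ (Y a) := fun a => by
    rcases a with i | i
    · exact hP.finite i
    · exact hWfin i
  have hYind : ∀ a, IsIndecomposable Λ (Y a) := fun a => by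
    rcases a with i | i
    · exact hP.indecomposable i
    · exact ⟨hWnt i i.2, hWtriv i⟩
  have hYiso : ∀ a b, Nonempty (Y a ≃ₗ[Λ] Y b) → a = b := by
    rintro (a | a) (b | b) ⟨e⟩
    · exact congrArg _ (Subtype.ext (hP.eq_of_iso a b ⟨e⟩))
    · exact ((hP.isEmpty_cosyzygy_equiv hNak (f b) (hf b)).false e.symm).elim
    · exact ((hP.isEmpty_cosyzygy_equiv hNak (f a) (hf a)).false e).elim
    · exact congrArg _ (Subtype.ext (hWiso a a.2 b b.2 e))
  have hYadd : ∀ a, MemAdd Λ (Y a) TC := fun a => by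
    rcases a with i | i
    · have := hinj i i.2
      exact hTC.memAdd_of_injective (X := P i)
    · have := hinj (j i) (hj i)
      obtain ⟨s, p, hps⟩ := hP.exists_retract_regular hNak (i : ZMod n)
      exact hTC.memAdd_of_exact hG s p hps (f i) (LinearMap.range (f i)).mkQ (hf i)
        (LinearMap.exact_map_mkQ_range _) (Submodule.mkQ_surjective _)
  obtain ⟨l, σ, ⟨e⟩⟩ := hP.exists_equiv_pi hbasic
  -- Unlike `Y`, this family may repeat modules and contains `W i = 0` for `i` in `setQ c`. That is
  -- harmless for locating summands of `T`, since a nonzero one can only match a nonzero `W i`.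
  let Z : ZMod n ⊕ ZMod n → ModuleCat.{u} Λ := Sum.elim (fun i => P (j i)) W
  have hZtriv : ∀ a, HasTrivialSummands Λ (Z a) := fun a => by
    rcases a with i | i
    · exact (hP.indecomposable (j i)).2
    · exact hWtriv i
  have hZadd : ∀ a, MemAdd Λ (Z a) (∀ a, Z a) := fun a => by
    obtain ⟨i, q, hqi⟩ := exists_retract_of_equiv_pi (LinearEquiv.refl Λ (∀ a, Z a)) a
    exact .of_retract_self i q hqi
  have hTadd : MemAdd Λ TC (∀ a, Z a) := by
    have : ∀ s, Module.Injective Λ (P (j (σ s))) := fun s => hinj _ (hj _)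
    have : Module.Injective Λ (∀ s, P (j (σ s))) := Module.Injective.pi Λ _
    refine memAdd_of_projectiveDimension_le_one hTC.projectiveDimension_le_one hG
      ((LinearMap.piMap fun s => f (σ s)) ∘ₗ e.toLinearMap)
      (LinearMap.piMap fun s => (LinearMap.range (f (σ s))).mkQ)
      ?_ ?_ ?_ (MemAdd.pi fun s => hZadd (.inl (σ s))) (MemAdd.pi fun s => hZadd (.inr (σ s)))
    · exact (Function.Injective.piMap fun s => hf (σ s)).comp e.injective
    · intro y
      constructor
      · intro hy
        have h1 : ∀ s, ∃ x, f (σ s) x = y s := fun s =>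
          (Submodule.Quotient.mk_eq_zero _).1 (congrFun hy s)
        choose x hx using h1
        exact ⟨e.symm x, funext fun s => by simpa using hx s⟩
      · rintro ⟨x, rfl⟩
        exact funext fun s => (Submodule.Quotient.mk_eq_zero _).2 ⟨_, rfl⟩
    · exact Function.Surjective.piMap fun s => Submodule.mkQ_surjective _
  have hXtriv : ∀ s, HasTrivialSummands Λ (X s) := fun s => (hXind s).2
  obtain ⟨eXY⟩ := nonempty_pi_equiv (X := fun s => X s) (Y := fun a => Y a) hXiso hYiso
    (fun s => by
      obtain ⟨i, q, hqi⟩ := exists_retract_of_equiv_pi (equivPiOfIsInternal hX) s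
      obtain ⟨a, ⟨ea⟩⟩ := (hTadd.of_retract i q hqi).exists_equiv (hXind s) hZtriv
        (LinearEquiv.refl Λ _)
      rcases a with i | i
      · exact ⟨.inl ⟨j i, hj i⟩, ⟨ea⟩⟩
      · have := (hXind s).1
        exact ⟨.inr ⟨i, hWP i ea.symm.toEquiv.nontrivial⟩, ⟨ea⟩⟩)
    (fun a => (hYadd a).exists_equiv (hYind a) hXtriv (equivPiOfIsInternal hX))
  exact ⟨equivPiOfIsInternal hX ≪≫ₗ eXY ≪≫ₗ
    LinearEquiv.sumPiEquivProdPi Λ (setQ c) (setP c) (fun a => Y a) ≪≫ₗ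
    LinearEquiv.prodCongr (DirectSum.linearEquivFunOnFintype Λ (setQ c) fun i => P i).symm
      (DirectSum.linearEquivFunOnFintype Λ (setP c) fun i => W i).symm⟩

end NakayamaTilting
theorem mainTheorem12 {k : Type u} [CommRing k] [IsArtinianRing k]
    {Λ : Type u} [Ring Λ] [Algebra k Λ] [Module.Finite k Λ]
    (hNak : NakayamaTilting.IsNakayama Λ)
    (hbasic : NakayamaTilting.IsBasicModule Λ Λ)
    (hconn : NakayamaTilting.IsConnectedRing Λ)
    {n : ℕ} [NeZero n] (P : ZMod n → ModuleCat.{u} Λ)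
    (hP : NakayamaTilting.IsKupischSeries k Λ P)
    (c : ZMod n → ℕ) (hc : ∀ i, Module.length Λ (P i) = c i)
    (TC : ModuleCat.{u} Λ) (hTC : NakayamaTilting.IsTilting Λ TC)
    (hmem : NakayamaTilting.MemC Λ TC) :
    ∃ T : NakayamaTilting.setP c → ModuleCat.{u} Λ,
      (∀ i, NakayamaTilting.IsUniserial Λ (T i) ∧
        Nonempty (NakayamaTilting.socle Λ (T i) ≃ₗ[Λ]
          NakayamaTilting.Top Λ (P ((i : ZMod n) + 1))) ∧
        Module.length Λ (T i) = NakayamaTilting.delta c (i : ZMod n)) ∧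
      Nonempty (TC ≃ₗ[Λ]
        (⨁ j : NakayamaTilting.setQ c, P (j : ZMod n)) ×
          (⨁ i : NakayamaTilting.setP c, T i)) := by
  exact NakayamaTilting.IsTilting.exists_decomposition hNak hbasic P hP c hc TC hTC hmem
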